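/- Let $\Xi$ be a real $s\times n$ matrix of rank $s$ with non-zero columns $\xi_1,\dots,\xi_n$, and let $$M_\Xi(x)=\frac{\operatorname{vol}_{n-s}\{t\in[0,1]^n:\Xi t=x\}}{\sqrt{\det(\Xi\Xi^T)}}\qquad(x\in\mathbb R^s)$$ be its (non-degenerate) box spline. Let the mesh of $M_\Xi$ be the union of all hyperplanes $\sum_{i\in A}\xi_i+H$, where $A\subseteq\{1,\dots,n\}$ and $H$ is spanned by $s-1$ linearly independent columns of $\Xi$ (it is empty if $s=0$). A matrix is a kernel matrix of a matrix $B$ if its columns form a basis of the null space of $B$ and it is in column echelon form, i.e. the row index of the first non-zero entry of a column strictly increases from each column to the next. Let $K$ be any kernel matrix of $\Xi$. For $\alpha\in\mathbb Z^n$ let $\|\alpha\|_0$ be the number of its non-zero entries. For every $\alpha$ with $s<\|\alpha\|_0\le n$ choose a vector $\nu_\alpha\in\mathbb R^n$ as follows: if $\|\alpha\|_0=n$, it is the first column of $K$; otherwise $\nu_\alpha=Kt_\alpha$, where $t_\alpha$ is the first column of some kernel matrix of the matrix consisting of the rows $j$ of $K$ with $\alpha(j)=0$. Put $m_\alpha=\min\{i:\nu_\alpha(i)\neq0\}$,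 and let $r_j(\alpha)$ be obtained from $\alpha$ by adding $1$ to the entry with index $m_\alpha$ and subtracting $1$ from the entry with index $j$. Define multisets (repeated pairs are counted with multiplicity) by $P_0=\{(1,(1,\dots,1))\}$ and $$P_k=\Big\{\Big(-c\,\tfrac{\nu_\alpha(j)}{\nu_\alpha(m_\alpha)},\,r_j(\alpha)\Big):(c,\alpha)\in P_{k-1},\ m_\alpha<j\le n,\ \nu_\alpha(j)\neq0\Big\}\qquad(1\le k\le n-s),$$ and let $S_\Xi$ be the multiset of the pairs $\big((-1)^{|A|},\sum_{i\in A}\xi_i\big)$, one for each $A\subseteq\{1,\dots,n\}$, so that $\sum_{(b,p)\in S_\Xi}b\,f(\cdot-p)=\prod_{i=1}^n(1-\tau_{\xi_i})f$ with $\tau_\xi f=f(\cdot-\xi)$. For $\alpha$ with $\|\alpha\|_0=s$ let $\Xi_\alpha$ be the $s\times s$ matrix of the columns $\xi_j$ with $\alpha(j)\ne0$ (in increasing order of $j$), and $\mu_\alpha$ the $s$-vector of the non-zero entries of $\alpha$ in the same order. For $y\in\mathbb R^s$ and $k\in\mathbb N_0^s$ let $[\![y]\!]_+^{k}=\prod_{j=1}^s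 (y_j)_+^{k_j}/k_j!$, where $u_+^k=u^k$ if $u\ge0$ and $u_+^k=0$ if $u<0$. Theorem. For every $(c,\alpha)\in P_{n-s}$ the entries of $\alpha$ are non-negative, exactly $s$ of them are non-zero, and $\det\Xi_\alpha\neq0$. The mesh has Lebesgue measure zero, and for every $x\in\mathbb R^s$ outside the mesh $$M_\Xi(x)=\sum_{(b,p)\in S_\Xi}\ \sum_{(c,\alpha)\in P_{n-s}}\frac{b\,c}{|\det\Xi_\alpha|}\,\big[\!\big[\Xi_\alpha^{-1}(x-p)\big]\!\big]_+^{\mu_\alpha-\mathbf 1}.$$ -/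

import Mathlib

open MeasureTheory

namespace BoxSpline

noncomputable section

/-- The closed unit cube in `ℝⁿ` (Euclidean norm). -/
def unitCube (n : ℕ) : Set (EuclideanSpace ℝ (Fin n)) :=
  {t | ∀ i, 0 ≤ t i ∧ t i ≤ 1}

/-- The box spline `M_Ξ` of an `s × n` matrix of rank `s`: the `(n - s)`-dimensional Euclidean
volume of the part of the unit cube that `Ξ` maps to `x`, divided by `√det(Ξ Ξᵀ)`. -/
def boxSpline {s n : ℕ} (Ξ : Matrix (Fin s) (Fin n) ℝ) (x : Fin s → ℝ) : ℝ :=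
  ((μHE[n - s] : Measure (EuclideanSpace ℝ (Fin n)))
      {t | t ∈ unitCube n ∧ Matrix.mulVec Ξ (fun i => t i) = x}).toReal
    / Real.sqrt (Ξ * Ξ.transpose).det

/-- The vertex `∑_{i ∈ A} ξ_i`, where `ξ_i` is the `i`-th column of `Ξ`. -/
def vertex {s n : ℕ} (Ξ : Matrix (Fin s) (Fin n) ℝ) (A : Finset (Fin n)) : Fin s → ℝ :=
  ∑ i ∈ A, Ξ.col i

/-- The mesh of `M_Ξ`: all translates, by vertices, of the hyperplanes that are spanned by
`s - 1` linearly independent columns of `Ξ`. -/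
def mesh {s n : ℕ} (Ξ : Matrix (Fin s) (Fin n) ℝ) : Set (Fin s → ℝ) :=
  {x | ∃ A B : Finset (Fin n), B.card + 1 = s ∧
    LinearIndependent ℝ (fun i : B => Ξ.col i) ∧
    x - vertex Ξ A ∈ Submodule.span ℝ (Ξ.col '' (B : Set (Fin n)))}

/-- The pairs `(b, p)` with `∏ᵢ (1 - shift by ξ_i) f = ∑_{(b,p)} b f(· - p)`, one pair for each
set of columns. -/
def diffPairs {s n : ℕ} (Ξ : Matrix (Fin s) (Fin n) ℝ) : Multiset (ℝ × (Fin s → ℝ)) :=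
  (Finset.univ : Finset (Finset (Fin n))).val.map fun A => ((-1) ^ A.card, vertex Ξ A)

/-- Column echelon form without zero columns: the row of the first non-zero entry strictly
increases from each column to the next. -/
def IsColEchelon {m d : ℕ} (K : Matrix (Fin m) (Fin d) ℝ) : Prop :=
  ∃ piv : Fin d → Fin m, StrictMono piv ∧
    ∀ j, K (piv j) j ≠ 0 ∧ ∀ i, i < piv j → K i j = 0

/-- `K` is a matrix in column echelon form whose columns are a basis of the kernel of `A`. -/
def IsKernelMatrix {ι : Type} {m d : ℕ} (A : Matrix ι (Fin m) ℝ)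
    (K : Matrix (Fin m) (Fin d) ℝ) : Prop :=
  IsColEchelon K ∧ LinearIndependent ℝ K.col ∧
    Submodule.span ℝ (Set.range K.col) = LinearMap.ker A.mulVecLin

/-- The set of indices of the non-zero entries of `α`. -/
def supp {n : ℕ} (α : Fin n → ℤ) : Finset (Fin n) := Finset.univ.filter fun i => α i ≠ 0

/-- The rows of `K` whose index `j` satisfies `α j = 0`. -/
def zeroRows {n d : ℕ} (K : Matrix (Fin n) (Fin d) ℝ) (α : Fin n → ℤ) :
    Matrix {j : Fin n // α j = 0} (Fin d) ℝ :=
  K.submatrix Subtype.val id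

/-- `v` is a vector `ν_α` for the kernel matrix `K`: the first column of `K` if `α` has no zero
entry, and otherwise `K t`, where `t` is the first column of a kernel matrix of the rows of `K`
selected by the zeros of `α`. -/
def IsNu {n d : ℕ} (K : Matrix (Fin n) (Fin d) ℝ) (α : Fin n → ℤ) (v : Fin n → ℝ) : Prop :=
  ((supp α).card = n ∧ ∃ h : 0 < d, v = K.col ⟨0, h⟩) ∨
  ((supp α).card < n ∧ ∃ (e : ℕ) (N : Matrix (Fin d) (Fin (e + 1)) ℝ),
    IsKernelMatrix (zeroRows K α) N ∧ v = K.mulVec (N.col 0))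

/-- `α ↦ r_j(α)`: add one to the entry `m`, subtract one from the entry `j`. -/
def shiftExp {n : ℕ} (m j : Fin n) (α : Fin n → ℤ) : Fin n → ℤ := fun i =>
  if i = m then α i + 1 else if i = j then α i - 1 else α i

open Classical in
/-- The family `P_k` of pairs `(c, α)`, counted with multiplicity. In the recursion, `mj.1` is the
index `m_α` of the first non-zero entry of `ν_α`, and `mj.2` is an index `j > m_α` with
`ν_α(j) ≠ 0`. -/
def greenPairs {n : ℕ} (ν : (Fin n → ℤ) → Fin n → ℝ) : ℕ → Multiset (ℝ × (Fin n → ℤ))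
  | 0 => {(1, fun _ => 1)}
  | k + 1 => (greenPairs ν k).bind fun q =>
      ((Finset.univ : Finset (Fin n × Fin n)).filter fun mj =>
        IsLeast {i | ν q.2 i ≠ 0} mj.1 ∧ mj.1 < mj.2 ∧ ν q.2 mj.2 ≠ 0).val.map fun mj =>
          (-q.1 * (ν q.2 mj.2 / ν q.2 mj.1), shiftExp mj.1 mj.2 q.2)

/-- `σ_α`: the increasing list of the indices of the non-zero entries of `α`. -/
def suppIdx {s n : ℕ} (α : Fin n → ℤ) (h : (supp α).card = s) : Fin s → Fin n :=
  (supp α).orderEmbOfFin h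

/-- `Ξ_α`: the square matrix of the columns of `Ξ` at the non-zero entries of `α`. -/
def subMatrix {s n : ℕ} (Ξ : Matrix (Fin s) (Fin n) ℝ) (α : Fin n → ℤ)
    (h : (supp α).card = s) : Matrix (Fin s) (Fin s) ℝ :=
  Ξ.submatrix id (suppIdx α h)

/-- The normalized truncated power `∏ⱼ (yⱼ)₊^{kⱼ} / kⱼ!`. -/
def truncPow {s : ℕ} (y : Fin s → ℝ) (k : Fin s → ℕ) : ℝ :=
  ∏ j, (if 0 ≤ y j then y j ^ k j else 0) / (Nat.factorial (k j) : ℝ)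

/-- `|det Ξ_α|⁻¹ ⟦Ξ_α⁻¹ y⟧₊^{μ_α - 1}` for an `α` with exactly `s` non-zero entries, where `μ_α` is
the vector of these entries (and `0` for every other `α`). -/
def greenTerm {s n : ℕ} (Ξ : Matrix (Fin s) (Fin n) ℝ) (α : Fin n → ℤ) (y : Fin s → ℝ) : ℝ :=
  if h : (supp α).card = s then
    truncPow ((subMatrix Ξ α h)⁻¹.mulVec y) (fun j => (α (suppIdx α h j) - 1).toNat)
      / |(subMatrix Ξ α h).det|
  else 0

end

end BoxSpline

namespace BoxSpline

open Function Filter Topology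

/-! As a distribution, $M_\Xi$ is $\varphi\mapsto\int_{[0,1]^n}\varphi(\Xi t)\,dt$: each column
contributes a difference $1-\tau_{\xi_i}$ and one formal inverse of the directional derivative
$D_{\xi_i}$. An exponent vector `α` stands for $\prod_i(1-\tau_{\xi_i})\prod_i
D_{\xi_i}^{-\alpha(i)}$. A relation $\sum_j\nu(j)\xi_j=0$ with first non-zero entry at $m$ gives
$D_{\xi_m}=-\sum_{j>m}\frac{\nu(j)}{\nu(m)}D_{\xi_j}$, and inserting $D_{\xi_m}D_{\xi_m}^{-1}$
replaces `α` by the vectors $r_j(\alpha)$ (`expPairing_eq_sum`, `sum_greenPairs`). After $n-s$ steps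
the support indexes a basis, and $\prod_i D_{\xi_i}^{-\alpha(i)}$ has a truncated power as density
(`expPairing_eq_integral`).

For dependent columns a product of half-line weights may diverge. Hence a factor with exponent 1
stays merged with its difference, as Lebesgue measure on $[0,1]$; only exponents at least 2 give
unbounded weights. Echelon form makes $m_\alpha$ the least index at which any relation supported on
`α` is non-zero (`IsNu.exists_isLeading`). So after each step all remaining relations vanish before
every index with exponent at least 2. This makes the unbounded columns independent
(`admissible_of_lead`) and forces $\alpha(j)=1$ whenever $j$ is lowered (`IsReduced.eq_one`).

Both sides then agree against test functions, hence almost everywhere; both are continuous off the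
closed mesh (`continuousOn_boxSpline`, `continuousOn_greenTerm`), hence equal there. -/

/-! ### One-dimensional weights and integration by parts. -/

/-- The three kinds of one-dimensional weights. -/
inductive Marginal
  | zero
  | unit
  | pow (k : ℕ)

/-- The density `t₊ᵏ / k!`. -/
noncomputable def powDensity (k : ℕ) (t : ℝ) : ℝ :=
  (if 0 ≤ t then t ^ k else 0) / (Nat.factorial k : ℝ)

/-- The Dirac measure at `0`, Lebesgue measure on `[0, 1]`, or the measure with density
`t₊ᵏ / k!`. -/
noncomputable def Marginal.measure : Marginal → Measure ℝ
  | zero => Measure.dirac 0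
  | unit => volume.restrict (Set.Icc 0 1)
  | pow k => volume.withDensity fun t => ENNReal.ofReal (powDensity k t)

lemma powDensity_nonneg (k : ℕ) (t : ℝ) : 0 ≤ powDensity k t := by
  unfold powDensity
  split_ifs with h <;> positivity

lemma measurable_powDensity (k : ℕ) : Measurable (powDensity k) := by
  unfold powDensity
  exact (Measurable.ite measurableSet_Ici (measurable_id.pow_const k)
    measurable_const).div_const _

lemma powDensity_le (k : ℕ) (t : ℝ) : powDensity k t ≤ |t| ^ k / (Nat.factorial k : ℝ) := by
  unfold powDensity
  gcongr
  split_ifs with h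
  · rw [abs_of_nonneg h]
  · positivity

lemma integral_pow (k : ℕ) (f : ℝ → ℝ) :
    ∫ t, f t ∂(Marginal.pow k).measure = ∫ t in Set.Ioi 0, t ^ k / (Nat.factorial k : ℝ) * f t := by
  rw [Marginal.measure, integral_withDensity_eq_integral_toReal_smul
    (measurable_powDensity k).ennreal_ofReal (by simp), ← integral_Ici_eq_integral_Ioi,
    ← integral_indicator measurableSet_Ici]
  refine integral_congr_ae (ae_of_all _ fun t => ?_)
  simp only [smul_eq_mul, ENNReal.toReal_ofReal (powDensity_nonneg k t)]
  by_cases h : 0 ≤ t <;> simp [powDensity, Set.indicator, h]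

instance (τ : Marginal) : SigmaFinite τ.measure := by
  cases τ <;> simp only [Marginal.measure] <;> infer_instance

instance (τ : Marginal) : IsLocallyFiniteMeasure τ.measure := by
  cases τ with
  | zero => simp only [Marginal.measure]; infer_instance
  | unit => simp only [Marginal.measure]; infer_instance
  | pow k =>
    refine ⟨fun x => ⟨Metric.ball x 1, Metric.ball_mem_nhds x one_pos, ?_⟩⟩
    rw [Marginal.measure, withDensity_apply _ measurableSet_ball]
    calc ∫⁻ t in Metric.ball x 1, ENNReal.ofReal (powDensity k t)
        ≤ ∫⁻ t in Metric.ball x 1, ENNReal.ofReal ((|x| + 1) ^ k / (Nat.factorial k : ℝ)) := by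
          refine setLIntegral_mono measurable_const fun t ht => ENNReal.ofReal_le_ofReal ?_
          refine (powDensity_le k t).trans ?_
          gcongr
          rw [Metric.mem_ball, Real.dist_eq] at ht
          have := abs_sub_abs_le_abs_sub t x
          linarith
      _ < ⊤ := by
          rw [setLIntegral_const]
          exact ENNReal.mul_lt_top ENNReal.ofReal_lt_top measure_ball_lt_top

lemma Marginal.ae_mem_Icc {τ : Marginal} (h : ∀ k, τ ≠ .pow k) :
    ∀ᵐ t ∂τ.measure, t ∈ Set.Icc (0 : ℝ) 1 := by
  cases τ with
  | zero => simp [Marginal.measure, ae_dirac_eq]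
  | unit => exact ae_restrict_mem measurableSet_Icc
  | pow k => exact absurd rfl (h k)

/-- Integration by parts on $(0,\infty)$ without boundary term: the power $t^{k+1}$ vanishes at 0
even for `k = 0`, and `g` vanishes at infinity. -/
lemma integral_pow_eq_neg {g g' : ℝ → ℝ} (hg : ∀ t, HasDerivAt g (g' t) t) (hg' : Continuous g')
    (hc : HasCompactSupport g) (hc' : HasCompactSupport g') (k : ℕ) :
    ∫ t, g t ∂(Marginal.pow k).measure = -∫ t, g' t ∂(Marginal.pow (k + 1)).measure := by
  have hgc : Continuous g := continuous_iff_continuousAt.2 fun t => (hg t).continuousAt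
  have i1 : Integrable fun t : ℝ => t ^ k / (Nat.factorial k : ℝ) * g t :=
    Continuous.integrable_of_hasCompactSupport (by fun_prop) hc.mul_left
  have i2 : Integrable fun t : ℝ => t ^ (k + 1) / (Nat.factorial (k + 1) : ℝ) * g' t :=
    Continuous.integrable_of_hasCompactSupport (by fun_prop) hc'.mul_left
  have hF : ∀ t, HasDerivAt (fun t => t ^ (k + 1) / (Nat.factorial (k + 1) : ℝ) * g t)
      (t ^ k / (Nat.factorial k : ℝ) * g t + t ^ (k + 1) / (Nat.factorial (k + 1) : ℝ) * g' t)
      t := by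
    intro t
    have := ((hasDerivAt_pow (k + 1) t).div_const (Nat.factorial (k + 1) : ℝ)).mul (hg t)
    refine this.congr_deriv ?_
    rw [Nat.factorial_succ]
    push_cast
    have : (Nat.factorial k : ℝ) ≠ 0 := by positivity
    field_simp
  have hlim : Tendsto (fun t : ℝ => t ^ (k + 1) / (Nat.factorial (k + 1) : ℝ) * g t) atTop
      (𝓝 0) := by
    have : HasCompactSupport fun t : ℝ => t ^ (k + 1) / (Nat.factorial (k + 1) : ℝ) * g t :=
      hc.mul_left
    exact this.is_zero_at_infty.mono_left atTop_le_cocompact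
  have := integral_Ioi_of_hasDerivAt_of_tendsto' (a := 0) (fun t _ => hF t)
    (i1.add i2).integrableOn hlim
  rw [integral_add i1.integrableOn i2.integrableOn] at this
  rw [integral_pow, integral_pow]
  simp only [ne_eq, Nat.add_eq_zero_iff, one_ne_zero, and_false, not_false_eq_true, zero_pow,
    zero_div, zero_mul, sub_zero] at this
  linarith

lemma integral_unit_deriv {g g' : ℝ → ℝ} (hg : ∀ t, HasDerivAt g (g' t) t)
    (hg' : Continuous g') : ∫ t, g' t ∂Marginal.unit.measure = g 1 - g 0 := by
  rw [Marginal.measure, integral_Icc_eq_integral_Ioc,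
    ← intervalIntegral.integral_of_le zero_le_one]
  exact intervalIntegral.integral_eq_sub_of_hasDerivAt (fun t _ => hg t)
    (hg'.intervalIntegrable _ _)

/-- The indicator of $[0,1]$ is almost everywhere that of $[0,\infty)$ minus its shift by 1; the
shift is moved onto `g`. -/
lemma integral_unit_eq_pow_zero {g : ℝ → ℝ} (hg : Continuous g) (hc : HasCompactSupport g) :
    ∫ t, g t ∂Marginal.unit.measure = ∫ t, (g t - g (t + 1)) ∂(Marginal.pow 0).measure := by
  have i1 : Integrable g := hg.integrable_of_hasCompactSupport hc
  have i2 : Integrable fun t => g (t + 1) := i1.comp_add_right 1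
  rw [integral_pow]
  simp only [pow_zero, Nat.factorial_zero, Nat.cast_one, div_one, one_mul]
  rw [integral_sub i1.integrableOn i2.integrableOn]
  have h1 : ∫ t in Set.Ioi (0 : ℝ), g (t + 1) = ∫ t in Set.Ioi (1 : ℝ), g t := by
    rw [← integral_indicator measurableSet_Ioi, ← integral_indicator measurableSet_Ioi,
      ← integral_add_right_eq_self ((Set.Ioi (1 : ℝ)).indicator g) 1]
    refine integral_congr_ae (ae_of_all _ fun t => ?_)
    simp [Set.indicator]
  rw [h1, Marginal.measure, integral_Icc_eq_integral_Ioc,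
    ← Set.Ioc_union_Ioi_eq_Ioi (zero_le_one' ℝ),
    setIntegral_union (Set.Ioc_disjoint_Ioi le_rfl) measurableSet_Ioi i1.integrableOn
      i1.integrableOn]
  ring

/-! ### Product weights: Fubini in one variable, and integrability. -/

/-- Fubini with the variable `i` innermost. It lifts each one-dimensional identity above to
`pairing`. -/
lemma integral_pi_eq_of_update {n : ℕ} (i : Fin n) (ρ ρ' : Fin n → Measure ℝ)
    [∀ j, SigmaFinite (ρ j)] [∀ j, SigmaFinite (ρ' j)] (hρ : ∀ j, j ≠ i → ρ' j = ρ j)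
    (f g : (Fin n → ℝ) → ℝ) (hf : Integrable f (Measure.pi ρ)) (hg : Integrable g (Measure.pi ρ'))
    (h : ∀ x, ∫ t, f (update x i t) ∂ρ i = ∫ t, g (update x i t) ∂ρ' i) :
    ∫ x, f x ∂Measure.pi ρ = ∫ x, g x ∂Measure.pi ρ' := by
  cases n with
  | zero => exact i.elim0
  | succ n =>
    have hrest : (fun j => ρ' (i.succAbove j)) = fun j => ρ (i.succAbove j) :=
      funext fun j => hρ _ (Fin.succAbove_ne i j)
    have mp := (measurePreserving_piFinSuccAbove ρ i).symm
    have mp' := (measurePreserving_piFinSuccAbove ρ' i).symm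
    rw [← mp.integral_comp', ← mp'.integral_comp',
      integral_prod_symm, integral_prod_symm]
    · have key : ∀ (y : Fin n → ℝ) (t : ℝ),
          (MeasurableEquiv.piFinSuccAbove (fun _ => ℝ) i).symm (t, y)
            = update (i.insertNth (0 : ℝ) y : Fin (n + 1) → ℝ) i t := by
        intro y t
        simp [MeasurableEquiv.piFinSuccAbove_symm_apply, Fin.insertNthEquiv]
      simp only [key, hrest, h]
    · exact (mp'.integrable_comp_emb (MeasurableEquiv.measurableEmbedding _)).2 hg
    · exact (mp.integrable_comp_emb (MeasurableEquiv.measurableEmbedding _)).2 hf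

/-- The weighted integral of `h ∘ Ξ`, with a weight of kind `τ i` in the variable `i`. -/
noncomputable def pairing {s n : ℕ} (Ξ : Matrix (Fin s) (Fin n) ℝ) (τ : Fin n → Marginal)
    (h : (Fin s → ℝ) → ℝ) : ℝ :=
  ∫ t, h (Ξ.mulVec t) ∂Measure.pi fun i => (τ i).measure

/-- The columns that belong to unbounded weights are linearly independent. -/
def Admissible {s n : ℕ} (Ξ : Matrix (Fin s) (Fin n) ℝ) (τ : Fin n → Marginal) : Prop :=
  ∀ c : Fin n → ℝ, Ξ.mulVec c = 0 → (∀ i, (∀ k, τ i ≠ .pow k) → c i = 0) → c = 0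

/-- On vectors carried by the unbounded coordinates `Ξ` is injective, hence bounded below; the other
coordinates lie in $[0,1]$ and contribute a bounded error. -/
lemma exists_bound_of_admissible {s n : ℕ} {Ξ : Matrix (Fin s) (Fin n) ℝ} {τ : Fin n → Marginal}
    (hτ : Admissible Ξ τ) (R : ℝ) : ∃ R' : ℝ, ∀ t : Fin n → ℝ,
      (∀ i, (∀ k, τ i ≠ .pow k) → t i ∈ Set.Icc (0 : ℝ) 1) → ‖Ξ.mulVec t‖ ≤ R → ‖t‖ ≤ R' := by
  classical
  let V : Submodule ℝ (Fin n → ℝ) :=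
    { carrier := {c | ∀ i, (∀ k, τ i ≠ .pow k) → c i = 0}
      add_mem' := fun {a b} ha hb i hi => by simp [ha i hi, hb i hi]
      zero_mem' := fun i _ => rfl
      smul_mem' := fun r a ha i hi => by simp [ha i hi] }
  have hinj : LinearMap.ker (Ξ.mulVecLin.domRestrict V) = ⊥ := by
    rw [LinearMap.ker_eq_bot']
    intro c hc
    exact Subtype.ext (hτ c.1 (by simpa using hc) c.2)
  obtain ⟨C, -, hC⟩ := LinearMap.exists_antilipschitzWith _ hinj
  obtain ⟨B, hB⟩ := (isCompact_closedBall (0 : Fin n → ℝ) 1).exists_bound_of_continuousOn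
    (f := fun t => Ξ.mulVec t) (Continuous.continuousOn (by fun_prop))
  refine ⟨C * (R + B) + 1, fun t ht hR => ?_⟩
  -- `u` keeps the bounded coordinates of `t`, so that `t - u` lies in `V`.
  set u : Fin n → ℝ := fun i => if ∀ k, τ i ≠ .pow k then t i else 0 with hu
  have hu1 : ‖u‖ ≤ 1 := by
    refine (pi_norm_le_iff_of_nonneg zero_le_one).2 fun i => ?_
    simp only [hu]
    split_ifs with h
    · rw [Real.norm_eq_abs, abs_of_nonneg (ht i h).1]; exact (ht i h).2
    · simp
  let c : V := ⟨t - u, fun i hi => by simp only [hu, Pi.sub_apply]; rw [if_pos hi, sub_self]⟩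
  have hc : ‖c‖ ≤ C * ‖Ξ.mulVec (t - u)‖ := by
    have := hC.le_mul_dist c 0
    simpa [dist_zero_right, c] using this
  have h2 : ‖Ξ.mulVec (t - u)‖ ≤ R + B := by
    rw [Matrix.mulVec_sub]
    exact (norm_sub_le _ _).trans (add_le_add hR (hB u (by simpa using hu1)))
  calc ‖t‖ = ‖(t - u) + u‖ := by simp
    _ ≤ ‖t - u‖ + ‖u‖ := norm_add_le _ _
    _ ≤ C * (R + B) + 1 := add_le_add (hc.trans (by gcongr)) hu1

/-- `h ∘ Ξ` need not have compact support, but almost everywhere for the weight it vanishes outside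
a fixed ball. -/
lemma integrable_comp_mulVec {s n : ℕ} {Ξ : Matrix (Fin s) (Fin n) ℝ} {τ : Fin n → Marginal}
    (hτ : Admissible Ξ τ) {h : (Fin s → ℝ) → ℝ} (hh : Continuous h) (hc : HasCompactSupport h) :
    Integrable (fun t => h (Ξ.mulVec t)) (Measure.pi fun i => (τ i).measure) := by
  obtain ⟨R, hR⟩ := hc.isCompact.isBounded.exists_norm_le
  obtain ⟨R', hR'⟩ := exists_bound_of_admissible hτ R
  have hcont : Continuous fun t => h (Ξ.mulVec t) := by fun_prop
  have hint : IntegrableOn (fun t => h (Ξ.mulVec t)) (Metric.closedBall 0 R')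
      (Measure.pi fun i => (τ i).measure) :=
    hcont.continuousOn.integrableOn_compact (isCompact_closedBall _ _)
  refine ((integrable_indicator_iff Metric.isClosed_closedBall.measurableSet).2 hint).congr ?_
  have hae : ∀ᵐ t ∂(Measure.pi fun i => (τ i).measure),
      ∀ i, (∀ k, τ i ≠ .pow k) → t i ∈ Set.Icc (0 : ℝ) 1 := by
    refine ae_all_iff.2 fun i => ?_
    by_cases hi : ∀ k, τ i ≠ .pow k
    · filter_upwards [(Measure.tendsto_eval_ae_ae (μ := fun i => (τ i).measure) (i := i)).eventually
        (Marginal.ae_mem_Icc hi)] with t ht _ using ht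
    · exact ae_of_all _ fun t h => absurd h hi
  filter_upwards [hae] with t ht
  by_cases hmem : t ∈ Metric.closedBall (0 : Fin n → ℝ) R'
  · rw [Set.indicator_of_mem hmem]
  · rw [Set.indicator_of_notMem hmem]
    by_contra hne
    exact hmem (mem_closedBall_zero_iff.2
      (hR' t ht (hR _ (subset_tsupport _ (mem_support.2 (Ne.symm hne))))))

/-! ### Derivatives and differences of test functions along columns. -/

lemma exists_mulVec_update {s n : ℕ} (Ξ : Matrix (Fin s) (Fin n) ℝ) (x : Fin n → ℝ) (i : Fin n) :
    ∃ y, ∀ t : ℝ, Ξ.mulVec (update x i t) = y + t • Ξ.col i := by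
  refine ⟨Ξ.mulVec (update x i 0), fun t => ?_⟩
  have : update x i t = update x i 0 + t • Pi.single i (1 : ℝ) := by
    ext j
    by_cases h : j = i
    · subst h; simp
    · simp [h]
  rw [this, Matrix.mulVec_add, Matrix.mulVec_smul, Matrix.mulVec_single_one]

lemma hasCompactSupport_comp_line {E : Type*} [NormedAddCommGroup E] [NormedSpace ℝ E]
    {h : E → ℝ} (hc : HasCompactSupport h) (y : E) {v : E} (hv : v ≠ 0) :
    HasCompactSupport fun t : ℝ => h (y + t • v) :=
  hc.comp_isClosedEmbedding
    ((Homeomorph.addLeft y).isClosedEmbedding.comp (isClosedEmbedding_smul_left hv))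

lemma hasDerivAt_comp_line {E : Type*} [NormedAddCommGroup E] [NormedSpace ℝ E]
    {h : E → ℝ} (hh : ContDiff ℝ 1 h) (y v : E) (t : ℝ) :
    HasDerivAt (fun t : ℝ => h (y + t • v)) (fderiv ℝ h (y + t • v) v) t := by
  have h1 : HasDerivAt (fun t : ℝ => y + t • v) v t := by
    simpa using ((hasDerivAt_id t).smul_const v).const_add y
  exact ((hh.differentiable one_ne_zero _).hasFDerivAt.comp_hasDerivAt t h1)

lemma continuous_dirDeriv {E : Type*} [NormedAddCommGroup E] [NormedSpace ℝ E]
    {h : E → ℝ} (hh : ContDiff ℝ 1 h) (v : E) : Continuous fun x => fderiv ℝ h x v :=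
  (hh.continuous_fderiv one_ne_zero).clm_apply continuous_const

/-- The backward difference `1 - shift` acting on a test function. -/
def diff {E : Type*} [AddCommGroup E] (v : E) (h : E → ℝ) : E → ℝ := fun x => h x - h (x + v)

lemma hasCompactSupport_diff {E : Type*} [NormedAddCommGroup E]
    {h : E → ℝ} (hc : HasCompactSupport h) (v : E) : HasCompactSupport (diff v h) :=
  hc.sub (hc.comp_homeomorph (Homeomorph.addRight v))

variable {s n : ℕ} {Ξ : Matrix (Fin s) (Fin n) ℝ}

/-- `hcol` ensures that `h` has compact support on each line in direction `Ξ.col m`, so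
`integral_pow_eq_neg` applies there. -/
lemma pairing_pow {τ τ' : Fin n → Marginal} {m : Fin n} {k : ℕ} (hm : τ m = .pow k)
    (hm' : τ' m = .pow (k + 1)) (hne : ∀ j, j ≠ m → τ' j = τ j) (hτ : Admissible Ξ τ)
    (hτ' : Admissible Ξ τ') (hcol : Ξ.col m ≠ 0) {h : (Fin s → ℝ) → ℝ} (hh : ContDiff ℝ 1 h)
    (hc : HasCompactSupport h) :
    pairing Ξ τ h = -pairing Ξ τ' fun x => fderiv ℝ h x (Ξ.col m) := by
  rw [pairing, pairing, ← integral_neg]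
  refine integral_pi_eq_of_update m _ _ (fun j hj => by rw [hne j hj]) _ _
    (integrable_comp_mulVec hτ hh.continuous hc)
    (integrable_comp_mulVec hτ' (continuous_dirDeriv hh _) (hc.fderiv_apply (𝕜 := ℝ) _)).neg
    fun x => ?_
  rw [hm, hm', integral_neg]
  obtain ⟨y, hy⟩ := exists_mulVec_update Ξ x m
  simp only [hy]
  exact integral_pow_eq_neg (hasDerivAt_comp_line hh _ _)
    ((continuous_dirDeriv hh _).comp (by fun_prop)) (hasCompactSupport_comp_line hc _ hcol)
    (hasCompactSupport_comp_line (hc.fderiv_apply (𝕜 := ℝ) _) _ hcol) k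

/-- Fundamental theorem of calculus: the boundary values at 0 and 1 form a difference, evaluated by
the Dirac weight. -/
lemma pairing_unit_deriv {τ τ' : Fin n → Marginal} {j : Fin n} (hj : τ j = .unit)
    (hj' : τ' j = .zero) (hne : ∀ i, i ≠ j → τ' i = τ i) (hτ : Admissible Ξ τ)
    (hτ' : Admissible Ξ τ') {h : (Fin s → ℝ) → ℝ} (hh : ContDiff ℝ 1 h)
    (hc : HasCompactSupport h) :
    pairing Ξ τ (fun x => fderiv ℝ h x (Ξ.col j)) = -pairing Ξ τ' (diff (Ξ.col j) h) := by
  have hcont : Continuous (diff (Ξ.col j) h) := by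
    have := hh.continuous; unfold diff; fun_prop
  rw [pairing, pairing, ← integral_neg]
  refine integral_pi_eq_of_update j _ _ (fun i hi => by rw [hne i hi]) _ _
    (integrable_comp_mulVec hτ (continuous_dirDeriv hh _) (hc.fderiv_apply (𝕜 := ℝ) _))
    (integrable_comp_mulVec hτ' hcont (hasCompactSupport_diff hc _)).neg fun x => ?_
  rw [hj, hj']
  obtain ⟨y, hy⟩ := exists_mulVec_update Ξ x j
  simp only [hy]
  rw [integral_unit_deriv (hasDerivAt_comp_line hh _ _)
    ((continuous_dirDeriv hh _).comp (by fun_prop))]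
  simp [Marginal.measure, diff]

lemma pairing_unit {τ τ' : Fin n → Marginal} {j : Fin n} (hj : τ j = .unit)
    (hj' : τ' j = .pow 0) (hne : ∀ i, i ≠ j → τ' i = τ i) (hτ : Admissible Ξ τ)
    (hτ' : Admissible Ξ τ') (hcol : Ξ.col j ≠ 0) {h : (Fin s → ℝ) → ℝ} (hh : Continuous h)
    (hc : HasCompactSupport h) :
    pairing Ξ τ h = pairing Ξ τ' (diff (Ξ.col j) h) := by
  have hcont : Continuous (diff (Ξ.col j) h) := by unfold diff; fun_prop
  refine integral_pi_eq_of_update j _ _ (fun i hi => by rw [hne i hi]) _ _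
    (integrable_comp_mulVec hτ hh hc) (integrable_comp_mulVec hτ' hcont (hasCompactSupport_diff hc _)) fun x => ?_
  rw [hj, hj']
  obtain ⟨y, hy⟩ := exists_mulVec_update Ξ x j
  simp only [hy, diff]
  rw [integral_unit_eq_pow_zero (g := fun t => h (y + t • Ξ.col j)) (by fun_prop)
    (hasCompactSupport_comp_line hc _ hcol)]
  simp only [add_smul, one_smul, add_assoc]

/-- The product of the differences `1 - shift by ξ_i`, `i ∈ B`, acting on a test function. -/
noncomputable def diffSet (Ξ : Matrix (Fin s) (Fin n) ℝ) (B : Finset (Fin n))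
    (φ : (Fin s → ℝ) → ℝ) : (Fin s → ℝ) → ℝ :=
  fun x => ∑ A ∈ B.powerset, (-1) ^ A.card * φ (x + vertex Ξ A)

lemma diffSet_empty (φ : (Fin s → ℝ) → ℝ) : diffSet Ξ ∅ φ = φ := by
  ext x; simp [diffSet, vertex]

lemma diffSet_insert {B : Finset (Fin n)} {i : Fin n} (hi : i ∉ B) (φ : (Fin s → ℝ) → ℝ) :
    diffSet Ξ (insert i B) φ = diff (Ξ.col i) (diffSet Ξ B φ) := by
  ext x
  simp only [diffSet, diff]
  rw [Finset.sum_powerset_insert hi, sub_eq_add_neg, ← Finset.sum_neg_distrib]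
  congr 1
  refine Finset.sum_congr rfl fun A hA => ?_
  have hiA : i ∉ A := fun h => hi (Finset.mem_powerset.1 hA h)
  rw [Finset.card_insert_of_notMem hiA, vertex, Finset.sum_insert hiA, pow_succ, ← add_assoc]
  simp [vertex]

lemma contDiff_diffSet (B : Finset (Fin n)) {φ : (Fin s → ℝ) → ℝ} (hφ : ContDiff ℝ 1 φ) :
    ContDiff ℝ 1 (diffSet Ξ B φ) := by
  unfold diffSet
  fun_prop

lemma hasCompactSupport_diffSet (B : Finset (Fin n)) {φ : (Fin s → ℝ) → ℝ}
    (hφ : HasCompactSupport φ) : HasCompactSupport (diffSet Ξ B φ) := by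
  induction B using Finset.induction_on with
  | empty => rwa [diffSet_empty]
  | insert i B hi ih => rw [diffSet_insert hi]; exact hasCompactSupport_diff ih _

/-! ### Exponent vectors and one step of the recursion. -/

/-- The kind of the weight that belongs to an exponent. -/
def kind (a : ℤ) : Marginal :=
  if a ≤ 0 then .zero else if a = 1 then .unit else .pow (a - 1).toNat

lemma kind_eq_pow {a : ℤ} {k : ℕ} (h : kind a = .pow k) : 2 ≤ a := by
  unfold kind at h
  split_ifs at h with h1 h2
  omega

/-- The functional on test functions that belongs to the exponent vector `α`. -/
noncomputable def expPairing (Ξ : Matrix (Fin s) (Fin n) ℝ) (α : Fin n → ℤ)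
    (φ : (Fin s → ℝ) → ℝ) : ℝ :=
  pairing Ξ (fun i => kind (α i)) (diffSet Ξ (Finset.univ.filter fun i => α i ≠ 1) φ)

/-- `v` is in the kernel of `Ξ` and vanishes where `α` does. -/
def IsRelation (Ξ : Matrix (Fin s) (Fin n) ℝ) (α : Fin n → ℤ) (v : Fin n → ℝ) : Prop :=
  Ξ.mulVec v = 0 ∧ ∀ j, α j = 0 → v j = 0

/-- `v` is a relation that does not vanish at `m`, while all relations vanish before `m`. -/
structure IsLeading (Ξ : Matrix (Fin s) (Fin n) ℝ) (α : Fin n → ℤ) (v : Fin n → ℝ)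
    (m : Fin n) : Prop where
  rel : IsRelation Ξ α v
  ne : v m ≠ 0
  least : ∀ w, IsRelation Ξ α w → ∀ l < m, w l = 0

/-- The exponent vectors that occur in the recursion. -/
structure IsReduced (Ξ : Matrix (Fin s) (Fin n) ℝ) (α : Fin n → ℤ) : Prop where
  nonneg : ∀ i, 0 ≤ α i
  span : Submodule.span ℝ (Ξ.col '' {i | α i ≠ 0}) = ⊤
  lead : ∀ i, 2 ≤ α i → ∀ w, IsRelation Ξ α w → ∀ l < i, w l = 0

lemma IsLeading.isLeast {α : Fin n → ℤ} {v : Fin n → ℝ} {m : Fin n} (h : IsLeading Ξ α v m) :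
    IsLeast {i | v i ≠ 0} m :=
  ⟨h.ne, fun i hi => le_of_not_gt fun hlt => hi (h.least v h.rel i hlt)⟩

lemma IsLeading.ne_zero {α : Fin n → ℤ} {v : Fin n → ℝ} {m j : Fin n} (h : IsLeading Ξ α v m)
    (hj : v j ≠ 0) : α j ≠ 0 := fun h0 => hj (h.rel.2 j h0)

/-- If `α j ≥ 2`, the relation `v` would vanish before `j`, in particular at `m`; if `α j = 0`, it
would vanish at `j`. -/
lemma IsReduced.eq_one {α : Fin n → ℤ} {v : Fin n → ℝ} {m j : Fin n} (hα : IsReduced Ξ α)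
    (h : IsLeading Ξ α v m) (hmj : m < j) (hj : v j ≠ 0) : α j = 1 := by
  have h0 := hα.nonneg j
  have h1 := h.ne_zero hj
  by_contra h2
  exact h.ne (hα.lead j (by omega) v h.rel m hmj)

/-- A relation carried by unbounded weights cannot have two non-zero entries, since the larger index
forces a zero at the smaller one. A single non-zero entry is impossible because no column is zero.
-/
lemma admissible_of_lead (hcol : ∀ j, Ξ.col j ≠ 0) {α : Fin n → ℤ} {τ : Fin n → Marginal}
    (h : ∀ i k, τ i = .pow k → α i ≠ 0 ∧ ∀ w, IsRelation Ξ α w → ∀ l < i, w l = 0) :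
    Admissible Ξ τ := by
  intro c hc h0
  have hp : ∀ i, c i ≠ 0 → ∃ k, τ i = .pow k := fun i hi => by
    by_contra hk
    push Not at hk
    exact hi (h0 i hk)
  have hrel : IsRelation Ξ α c := ⟨hc, fun j hj => by
    by_contra hne
    obtain ⟨k, hk⟩ := hp j hne
    exact (h j k hk).1 hj⟩
  by_contra hne
  obtain ⟨i, hi⟩ := Function.ne_iff.1 hne
  have hs : c = Pi.single i (c i) := by
    ext j
    by_cases hj : j = i
    · subst hj; simp
    · rw [Pi.single_eq_of_ne hj]
      by_contra hcj
      obtain ⟨k, hk⟩ := hp j hcj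
      obtain ⟨k', hk'⟩ := hp i hi
      rcases lt_or_gt_of_ne hj with hlt | hlt
      · exact hcj ((h i k' hk').2 c hrel j hlt)
      · exact hi ((h j k hk).2 c hrel i hlt)
  have hs' : c = c i • Pi.single i (1 : ℝ) := by
    rw [← Pi.single_smul, smul_eq_mul, mul_one]
    exact hs
  rw [hs', Matrix.mulVec_smul, Matrix.mulVec_single_one, smul_eq_zero] at hc
  exact hc.elim hi (hcol i)

lemma IsLeading.col_eq {α : Fin n → ℤ} {v : Fin n → ℝ} {m : Fin n} (h : IsLeading Ξ α v m) :
    Ξ.col m = ∑ j with m < j ∧ v j ≠ 0, (-(v j / v m)) • Ξ.col j := by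
  have h1 : ∑ j, v j • Ξ.col j = 0 := by
    rw [← h.rel.1]
    ext i
    simp [Matrix.mulVec, dotProduct, mul_comm]
  rw [← Finset.add_sum_erase _ _ (Finset.mem_univ m)] at h1
  have h2 : ∑ j ∈ Finset.univ.erase m, v j • Ξ.col j
      = ∑ j with m < j ∧ v j ≠ 0, v j • Ξ.col j := by
    symm
    refine Finset.sum_subset (fun j hj => ?_) fun j hj hj' => ?_
    · simp only [Finset.mem_filter] at hj
      simp [hj.2.1.ne']
    · simp only [Finset.mem_filter, Finset.mem_univ, true_and, not_and, not_not,
        Finset.mem_erase, and_true] at hj hj'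
      rcases lt_or_gt_of_ne hj with hlt | hlt
      · rw [h.least v h.rel j hlt, zero_smul]
      · rw [hj' hlt, zero_smul]
  rw [h2] at h1
  have h3 : Ξ.col m = (v m)⁻¹ • (v m • Ξ.col m) := by rw [smul_smul, inv_mul_cancel₀ h.ne, one_smul]
  rw [h3, eq_neg_of_add_eq_zero_left h1, smul_neg, Finset.smul_sum, ← Finset.sum_neg_distrib]
  refine Finset.sum_congr rfl fun j _ => ?_
  rw [smul_smul, ← neg_smul]
  congr 1
  ring

/-- One inverse derivative in direction $\xi_m$ is added and compensated by $D_{\xi_m}$; the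
relation expands $D_{\xi_m}$, and each $D_{\xi_j}$ is absorbed by the unit weight of the variable
`j`. -/
lemma expPairing_eq_sum (hcol : ∀ j, Ξ.col j ≠ 0) {α : Fin n → ℤ} (hα : IsReduced Ξ α)
    {v : Fin n → ℝ} {m : Fin n} (hv : IsLeading Ξ α v m) {φ : (Fin s → ℝ) → ℝ}
    (hφ : ContDiff ℝ 1 φ) (hc : HasCompactSupport φ) :
    expPairing Ξ α φ = ∑ j with m < j ∧ v j ≠ 0,
      -(v j / v m) * expPairing Ξ (shiftExp m j α) φ := by
  set B : Finset (Fin n) := Finset.univ.filter fun i => α i ≠ 1 with hB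
  set h := diffSet Ξ (insert m B) φ with hh
  set κ : Fin n → Marginal := fun i => kind (α i) with hκ
  set k := (α m - 1).toNat with hk
  have hm0 := hv.ne_zero hv.ne
  have hm1 := hα.nonneg m
  have hhd : ContDiff ℝ 1 h := contDiff_diffSet _ hφ
  have hhc : HasCompactSupport h := hasCompactSupport_diffSet _ hc
  have hadm : ∀ τ : Fin n → Marginal, (∀ i k, τ i = .pow k → i = m ∨ 2 ≤ α i) →
      Admissible Ξ τ := by
    intro τ hτ
    refine admissible_of_lead (α := α) hcol fun i k hik => ?_
    rcases hτ i k hik with rfl | h2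
    · exact ⟨hm0, hv.least⟩
    · exact ⟨by omega, hα.lead i h2⟩
  have hadmκ : ∀ μ : Marginal, Admissible Ξ (update κ m μ) := by
    intro μ
    refine hadm _ fun i k hik => ?_
    by_cases him : i = m
    · exact Or.inl him
    · rw [update_of_ne him] at hik
      exact Or.inr (kind_eq_pow hik)
  -- The weight at `m` becomes a half-line power in either case: for `α m = 1` its difference is
  -- split off, otherwise that difference is already among those in `B`.
  have step1 : expPairing Ξ α φ = pairing Ξ (update κ m (.pow k)) h := by
    by_cases h1 : α m = 1
    · have hmB : m ∉ B := by simp [hB, h1]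
      rw [expPairing, hh, diffSet_insert hmB]
      refine pairing_unit (by simp [kind, h1]) (by simp [hk, h1])
        (fun i hi => update_of_ne hi _ _) (hadm _ fun i k hik => Or.inr (kind_eq_pow hik))
        (hadmκ _) (hcol m) (contDiff_diffSet _ hφ).continuous (hasCompactSupport_diffSet _ hc)
    · have hmB : m ∈ B := by simp [hB, h1]
      have : update κ m (.pow k) = κ := by
        rw [update_eq_self_iff, hκ]
        simp only [kind]
        rw [if_neg (by omega), if_neg h1]
      rw [expPairing, this, hh, Finset.insert_eq_of_mem hmB]
  have step2 := pairing_pow (m := m) (k := k) (τ := update κ m (.pow k))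
    (τ' := update κ m (.pow (k + 1))) (by simp) (by simp)
    (fun j hj => by rw [update_of_ne hj, update_of_ne hj]) (hadmκ _) (hadmκ _) (hcol m) hhd hhc
  rw [step1, step2]
  -- Since `α j = 1`, integrating $D_{\xi_j}$ turns a unit weight into a Dirac weight and releases
  -- the difference for `j`.
  have step3 : ∀ j ∈ Finset.univ.filter (fun j => m < j ∧ v j ≠ 0),
      pairing Ξ (update κ m (.pow (k + 1))) (fun x => fderiv ℝ h x (Ξ.col j))
        = -expPairing Ξ (shiftExp m j α) φ := by
    intro j hj
    simp only [Finset.mem_filter, Finset.mem_univ, true_and] at hj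
    have hj1 : α j = 1 := hα.eq_one hv hj.1 hj.2
    have hjm : j ≠ m := hj.1.ne'
    have hfam : (fun i => kind (shiftExp m j α i))
        = update (update κ m (.pow (k + 1))) j .zero := by
      ext i : 1
      by_cases hij : i = j
      · subst hij
        simp [shiftExp, hjm, hj1, kind]
      · rw [update_of_ne hij]
        by_cases him : i = m
        · subst him
          rw [update_self]
          simp only [shiftExp, if_pos, kind]
          rw [if_neg (by omega), if_neg (by omega)]
          congr 1
          omega
        · rw [update_of_ne him]
          simp [shiftExp, him, hij, hκ]
    have hset : (Finset.univ.filter fun i => shiftExp m j α i ≠ 1) = insert j (insert m B) := by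
      ext i
      rw [Finset.mem_filter]
      simp only [Finset.mem_filter, Finset.mem_univ, true_and, Finset.mem_insert, hB, shiftExp]
      by_cases him : i = m
      · subst him; simp; omega
      · by_cases hij : i = j
        · subst hij; simp [him, hj1]
        · simp [him, hij]
    have hjB : j ∉ insert m B := by simp [hB, hjm, hj1]
    rw [expPairing, hfam, hset, diffSet_insert hjB, ← hh]
    refine pairing_unit_deriv (by rw [update_of_ne hjm]; simp [hκ, kind, hj1]) (by simp)
      (fun i hi => update_of_ne hi _ _) (hadmκ _) (hadm _ fun i k' hik => ?_) hhd hhc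
    by_cases hij : i = j
    · subst hij; simp at hik
    · rw [update_of_ne hij] at hik
      by_cases him : i = m
      · exact Or.inl him
      · rw [update_of_ne him] at hik
        exact Or.inr (kind_eq_pow hik)
  have step4 : pairing Ξ (update κ m (.pow (k + 1))) (fun x => fderiv ℝ h x (Ξ.col m))
      = ∑ j with m < j ∧ v j ≠ 0, -(v j / v m) *
        pairing Ξ (update κ m (.pow (k + 1))) (fun x => fderiv ℝ h x (Ξ.col j)) := by
    simp only [pairing]
    rw [hv.col_eq]
    simp only [map_sum, map_smul, smul_eq_mul]
    rw [integral_finsetSum]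
    · simp only [integral_const_mul]
    · intro j _
      exact (integrable_comp_mulVec (hadmκ _) (continuous_dirDeriv hhd _)
        (hhc.fderiv_apply (𝕜 := ℝ) _)).const_mul _
  rw [step4, ← Finset.sum_neg_distrib]
  refine Finset.sum_congr rfl fun j hj => ?_
  rw [step3 j hj]
  ring

/-- Only `j` leaves the support, and by `v` its column is a combination of the remaining ones, so
the span survives. Relations for the smaller support are relations for the old one, so they vanish
before `m`, the only entry that is raised. -/
lemma IsReduced.shiftExp {α : Fin n → ℤ} (hα : IsReduced Ξ α)
    {v : Fin n → ℝ} {m j : Fin n} (hv : IsLeading Ξ α v m) (hmj : m < j) (hj : v j ≠ 0) :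
    IsReduced Ξ (shiftExp m j α) ∧ (supp (shiftExp m j α)).card + 1 = (supp α).card := by
  have hj1 : α j = 1 := hα.eq_one hv hmj hj
  have hm0 := hv.ne_zero hv.ne
  have hm1 := hα.nonneg m
  have hne : ∀ i, BoxSpline.shiftExp m j α i ≠ 0 ↔ α i ≠ 0 ∧ i ≠ j := by
    intro i
    simp only [BoxSpline.shiftExp]
    by_cases him : i = m
    · subst him; simp [hmj.ne]; omega
    · by_cases hij : i = j
      · subst hij; simp [him, hj1]
      · simp [him, hij]
  have hrel : ∀ w, IsRelation Ξ (BoxSpline.shiftExp m j α) w → IsRelation Ξ α w := by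
    refine fun w hw => ⟨hw.1, fun i hi => hw.2 i ?_⟩
    by_contra h
    exact ((hne i).1 h).1 hi
  refine ⟨⟨fun i => ?_, ?_, fun i hi w hw => ?_⟩, ?_⟩
  · have := hα.nonneg i
    simp only [BoxSpline.shiftExp]
    split_ifs with h1 h2
    · omega
    · subst h2; omega
    · exact this
  · rw [eq_top_iff, ← hα.span, Submodule.span_le]
    rintro _ ⟨i, hi, rfl⟩
    by_cases hij : i = j
    · subst hij
      have h1 : ∑ l, v l • Ξ.col l = 0 := by
        rw [← hv.rel.1]
        ext l
        simp [Matrix.mulVec, dotProduct, mul_comm]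
      rw [← Finset.add_sum_erase _ _ (Finset.mem_univ i)] at h1
      have h2 : Ξ.col i = (v i)⁻¹ • -∑ l ∈ Finset.univ.erase i, v l • Ξ.col l := by
        rw [← eq_neg_of_add_eq_zero_left h1, smul_smul, inv_mul_cancel₀ hj, one_smul]
      rw [h2]
      refine Submodule.smul_mem _ _ (Submodule.neg_mem _ (Submodule.sum_mem _ fun l hl => ?_))
      by_cases hl0 : v l = 0
      · simp [hl0]
      · exact Submodule.smul_mem _ _ (Submodule.subset_span ⟨l, (hne l).2
          ⟨hv.ne_zero hl0, (Finset.mem_erase.1 hl).1⟩, rfl⟩)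
    · exact Submodule.subset_span ⟨i, (hne i).2 ⟨hi, hij⟩, rfl⟩
  · by_cases him : i = m
    · subst him; exact hv.least w (hrel w hw)
    · refine hα.lead i ?_ w (hrel w hw)
      simp only [BoxSpline.shiftExp, if_neg him] at hi
      split_ifs at hi <;> omega
  · have : supp (BoxSpline.shiftExp m j α) = (supp α).erase j := by
      ext i
      simp only [supp, Finset.mem_filter, Finset.mem_univ, true_and, Finset.mem_erase]
      rw [hne i, and_comm]
    rw [this, Finset.card_erase_add_one]
    simp [supp, hj1]

/-! ### Echelon form and the leading index of `ν`. -/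

/-- Columns before `p` have zero coefficients, and columns after `p` still vanish in row `piv p`.
Thus an echelon matrix respects leading positions. -/
lemma mulVec_eq_zero_of_lt {m d : ℕ} {K : Matrix (Fin m) (Fin d) ℝ} {piv : Fin d → Fin m}
    (hK : ∀ j, K (piv j) j ≠ 0 ∧ ∀ i, i < piv j → K i j = 0) (hp : StrictMono piv)
    {t : Fin d → ℝ} {p : Fin d} (ht : ∀ l < p, t l = 0) :
    (∀ i < piv p, K.mulVec t i = 0) ∧ K.mulVec t (piv p) = K (piv p) p * t p := by
  constructor
  · intro i hi
    rw [Matrix.mulVec, dotProduct]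
    refine Finset.sum_eq_zero fun l _ => ?_
    rcases lt_or_ge l p with h | h
    · rw [ht l h, mul_zero]
    · rw [(hK l).2 i (hi.trans_le (hp.monotone h)), zero_mul]
  · rw [Matrix.mulVec, dotProduct]
    refine Finset.sum_eq_single p (fun l _ hl => ?_) (by simp)
    rcases lt_or_gt_of_ne hl with h | h
    · rw [ht l h, mul_zero]
    · rw [(hK l).2 _ (hp h), zero_mul]

lemma IsKernelMatrix.exists_mulVec {ι : Type} {m d : ℕ} {A : Matrix ι (Fin m) ℝ}
    {K : Matrix (Fin m) (Fin d) ℝ} (hK : IsKernelMatrix A K) {v : Fin m → ℝ}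
    (hv : A.mulVec v = 0) : ∃ t, v = K.mulVec t := by
  have : v ∈ Submodule.span ℝ (Set.range K.col) := by
    rw [hK.2.2]; simpa using hv
  rw [← Matrix.range_mulVecLin] at this
  obtain ⟨t, ht⟩ := this
  exact ⟨t, ht.symm⟩

lemma IsKernelMatrix.mulVec_mulVec {ι : Type} {m d : ℕ} {A : Matrix ι (Fin m) ℝ}
    {K : Matrix (Fin m) (Fin d) ℝ} (hK : IsKernelMatrix A K) (t : Fin d → ℝ) :
    A.mulVec (K.mulVec t) = 0 := by
  have : K.mulVec t ∈ LinearMap.ker A.mulVecLin := by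
    rw [← hK.2.2, ← Matrix.range_mulVecLin]
    exact ⟨t, rfl⟩
  simpa using this

/-- The first column of an echelon matrix has the smallest pivot, and every vector of the column
span vanishes before it. Used for `N` and then for `K`, this makes the leading index minimal among
all relations, whichever kernel matrices are chosen. -/
lemma IsNu.exists_isLeading {d : ℕ} {K : Matrix (Fin n) (Fin d) ℝ} (hK : IsKernelMatrix Ξ K)
    {α : Fin n → ℤ} {v : Fin n → ℝ} (hv : IsNu K α v) : ∃ m, IsLeading Ξ α v m := by
  obtain ⟨piv, hp, hpiv⟩ := hK.1
  rcases hv with ⟨hcard, h0, rfl⟩ | ⟨-, e, N, hN, rfl⟩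
  · have hα : ∀ i, α i ≠ 0 := by
      have : supp α = Finset.univ := (Finset.card_eq_iff_eq_univ _).1 (by simpa using hcard)
      intro i
      have hi : i ∈ supp α := by rw [this]; exact Finset.mem_univ i
      simpa [supp] using hi
    refine ⟨piv ⟨0, h0⟩, ⟨?_, fun j hj => absurd hj (hα j)⟩, (hpiv _).1, fun w hw => ?_⟩
    · rw [← Matrix.mulVec_single_one]
      exact hK.mulVec_mulVec _
    · obtain ⟨t, rfl⟩ := hK.exists_mulVec hw.1
      exact (mulVec_eq_zero_of_lt hpiv hp
        fun l hl => absurd (Fin.lt_def.1 hl) (Nat.not_lt_zero _)).1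
  · obtain ⟨pivN, hpN, hpivN⟩ := hN.1
    have hrows : ∀ t, (zeroRows K α).mulVec t = 0 ↔ ∀ j, α j = 0 → K.mulVec t j = 0 := by
      intro t
      rw [funext_iff, Subtype.forall]
      rfl
    have ht : ∀ l < pivN 0, N.col 0 l = 0 := fun l hl => (hpivN 0).2 l hl
    have hlead := mulVec_eq_zero_of_lt hpiv hp ht
    refine ⟨piv (pivN 0), ⟨hK.mulVec_mulVec _, (hrows _).1 ?_⟩, ?_, fun w hw => ?_⟩
    · rw [← Matrix.mulVec_single_one]
      exact hN.mulVec_mulVec _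
    · rw [hlead.2]
      exact mul_ne_zero (hpiv _).1 (hpivN 0).1
    · obtain ⟨t, rfl⟩ := hK.exists_mulVec hw.1
      obtain ⟨r, rfl⟩ := hN.exists_mulVec ((hrows t).2 hw.2)
      exact (mulVec_eq_zero_of_lt hpiv hp (mulVec_eq_zero_of_lt hpivN hpN (t := r) (p := 0)
        fun l hl => absurd hl (Fin.not_lt_zero l)).1).1

/-! ### Iterating the recursion. -/

lemma span_col_eq_top (hrank : Ξ.rank = s) : Submodule.span ℝ (Set.range Ξ.col) = ⊤ := by
  rw [← Matrix.range_mulVecLin]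
  refine Submodule.eq_top_of_finrank_eq ?_
  rw [Module.finrank_fin_fun]
  exact hrank

lemma isReduced_one (hrank : Ξ.rank = s) : IsReduced Ξ fun _ => 1 := by
  refine ⟨fun _ => zero_le_one, ?_, fun i hi => by norm_num at hi⟩
  simpa using span_col_eq_top hrank

section greenPairs

variable {K : Matrix (Fin n) (Fin (n - s)) ℝ} {ν : (Fin n → ℤ) → Fin n → ℝ}

lemma mem_greenPairs (hrank : Ξ.rank = s) (hK : IsKernelMatrix Ξ K)
    (hν : ∀ α : Fin n → ℤ, s < (supp α).card → IsNu K α (ν α)) (k : ℕ) (hk : k + s ≤ n) :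
    ∀ q ∈ greenPairs ν k, IsReduced Ξ q.2 ∧ (supp q.2).card + k = n := by
  induction k with
  | zero =>
    intro q hq
    rw [greenPairs, Multiset.mem_singleton] at hq
    subst hq
    exact ⟨isReduced_one hrank, by simp [supp]⟩
  | succ k ih =>
    intro q hq
    rw [greenPairs, Multiset.mem_bind] at hq
    obtain ⟨p, hp, hq⟩ := hq
    obtain ⟨hred, hcard⟩ := ih (by omega) p hp
    rw [Multiset.mem_map] at hq
    obtain ⟨⟨m, j⟩, hmj, rfl⟩ := hq
    simp only [Finset.mem_val, Finset.mem_filter, Finset.mem_univ, true_and] at hmj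
    -- The support has `n - k > s` entries, as `hν` requires.
    obtain ⟨m', hm'⟩ := (hν p.2 (by omega)).exists_isLeading hK
    obtain rfl : m = m' := hmj.1.unique hm'.isLeast
    have := hred.shiftExp hm' hmj.2.1 hmj.2.2
    exact ⟨this.1, by have := this.2; simp only; omega⟩

lemma sum_greenPairs (hrank : Ξ.rank = s) (hcol : ∀ j, Ξ.col j ≠ 0) (hK : IsKernelMatrix Ξ K)
    (hν : ∀ α : Fin n → ℤ, s < (supp α).card → IsNu K α (ν α)) {φ : (Fin s → ℝ) → ℝ}
    (hφ : ContDiff ℝ 1 φ) (hc : HasCompactSupport φ) (k : ℕ) (hk : k + s ≤ n) :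
    ((greenPairs ν k).map fun q => q.1 * expPairing Ξ q.2 φ).sum
      = expPairing Ξ (fun _ => 1) φ := by
  induction k with
  | zero => simp [greenPairs]
  | succ k ih =>
    rw [← ih (by omega), greenPairs, Multiset.map_bind, Multiset.sum_bind]
    congr 1
    refine Multiset.map_congr rfl fun p hp => ?_
    obtain ⟨hred, hcard⟩ := mem_greenPairs hrank hK hν k (by omega) p hp
    obtain ⟨m, hm⟩ := (hν p.2 (by omega)).exists_isLeading hK
    rw [Multiset.map_map, expPairing_eq_sum hcol hred hm hφ hc, Finset.mul_sum,
      Finset.sum_map_val]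
    -- Least elements are unique, so the first component of every filtered pair is `m` and the sum
    -- runs over `j` alone.
    refine Finset.sum_bij' (fun mj _ => mj.2) (fun j _ => (m, j)) ?_ ?_ ?_ ?_ ?_
    · rintro ⟨m', j⟩ h
      simp only [Finset.mem_filter, Finset.mem_univ, true_and] at h ⊢
      obtain rfl : m' = m := h.1.unique hm.isLeast
      exact h.2
    · intro j h
      simp only [Finset.mem_filter, Finset.mem_univ, true_and] at h ⊢
      exact ⟨hm.isLeast, h⟩
    · rintro ⟨m', j⟩ h
      simp only [Finset.mem_filter, Finset.mem_univ, true_and] at h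
      obtain rfl : m' = m := h.1.unique hm.isLeast
      rfl
    · intro j _
      rfl
    · rintro ⟨m', j⟩ h
      simp only [Finset.mem_filter, Finset.mem_univ, true_and] at h
      obtain rfl : m' = m := h.1.unique hm.isLeast
      simp only [comp]
      ring

end greenPairs

/-! ### Exponents with `s` non-zero entries: densities of Green's functions. -/

lemma IsReduced.det_ne_zero {α : Fin n → ℤ} (hα : IsReduced Ξ α) (h : (supp α).card = s) :
    (subMatrix Ξ α h).det ≠ 0 := by
  have hspan : Submodule.span ℝ (Set.range (subMatrix Ξ α h).col) = ⊤ := by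
    rw [← hα.span]
    congr 1
    have hr : Set.range (suppIdx α h) = {i | α i ≠ 0} := by
      rw [suppIdx, Finset.range_orderEmbOfFin]
      simp [supp]
    rw [← hr, ← Set.range_comp]
    rfl
  have hli : LinearIndependent ℝ (subMatrix Ξ α h).col :=
    linearIndependent_of_top_le_span_of_card_eq_finrank hspan.ge (by simp)
  have := Matrix.linearIndependent_cols_iff_isUnit.1 hli
  exact ((Matrix.isUnit_iff_isUnit_det _).1 this).ne_zero

lemma lintegral_pi_prod {n : ℕ} (μ : Fin n → Measure ℝ) [∀ i, SigmaFinite (μ i)]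
    (f : Fin n → ℝ → ENNReal) (hf : ∀ i, Measurable (f i)) :
    ∫⁻ x, ∏ i, f i (x i) ∂Measure.pi μ = ∏ i, ∫⁻ x, f i x ∂μ i := by
  induction n with
  | zero => simp
  | succ n ih =>
    rw [← ((measurePreserving_piFinSuccAbove μ 0).symm).lintegral_comp_emb
      (MeasurableEquiv.measurableEmbedding _), Fin.prod_univ_succ,
      ← ih (fun i => μ i.succ) (fun i => f i.succ) fun i => hf _, ← lintegral_prod_mul]
    · simp_rw [MeasurableEquiv.piFinSuccAbove_symm_apply, Fin.insertNthEquiv,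
        Fin.prod_univ_succ, Fin.insertNth_zero, Equiv.coe_fn_mk, Fin.cons_succ,
        Fin.zero_succAbove, cast_eq, Fin.cons_zero]
    · exact (hf 0).aemeasurable
    · exact (Finset.measurable_prod _ fun i _ =>
        (hf i.succ).comp (measurable_pi_apply i)).aemeasurable

lemma pi_withDensity {n : ℕ} (μ : Fin n → Measure ℝ) [∀ i, SigmaFinite (μ i)]
    (f : Fin n → ℝ → ENNReal) (hf : ∀ i, Measurable (f i))
    [∀ i, SigmaFinite ((μ i).withDensity (f i))] :
    Measure.pi (fun i => (μ i).withDensity (f i))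
      = (Measure.pi μ).withDensity fun x => ∏ i, f i (x i) := by
  refine Measure.pi_eq fun S hS => ?_
  have hbox : MeasurableSet (Set.univ.pi S) := MeasurableSet.univ_pi hS
  rw [withDensity_apply _ hbox, ← lintegral_indicator hbox]
  have : (Set.univ.pi S).indicator (fun x => ∏ i, f i (x i))
      = fun x => ∏ i, (S i).indicator (f i) (x i) := by
    ext x
    by_cases hx : x ∈ Set.univ.pi S
    · rw [Set.indicator_of_mem hx]
      exact Finset.prod_congr rfl fun i _ => (Set.indicator_of_mem (hx i trivial) _).symm
    · rw [Set.indicator_of_notMem hx]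
      simp only [Set.mem_pi, Set.mem_univ, true_imp_iff, not_forall] at hx
      obtain ⟨i, hi⟩ := hx
      exact (Finset.prod_eq_zero (Finset.mem_univ i) (Set.indicator_of_notMem hi _)).symm
  rw [this, lintegral_pi_prod _ _ fun i => (hf i).indicator (hS i)]
  refine Finset.prod_congr rfl fun i _ => ?_
  rw [lintegral_indicator (hS i), withDensity_apply _ (hS i)]

lemma measurable_extend_zero {s n : ℕ} {σ : Fin s → Fin n} (hσ : Injective σ) :
    Measurable fun u : Fin s → ℝ => extend σ u (0 : Fin n → ℝ) := by
  refine measurable_pi_iff.2 fun i => ?_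
  by_cases h : ∃ j, σ j = i
  · obtain ⟨j, rfl⟩ := h
    simpa only [hσ.extend_apply] using measurable_pi_apply j
  · simp only [extend_apply' _ _ _ h]
    exact measurable_const

/-- A Dirac factor pins its coordinate to 0, so the product measure lives on the coordinate subspace
of the range of `σ`. -/
lemma pi_dirac_eq_map_extend {s n : ℕ} {σ : Fin s → Fin n} (hσ : Injective σ)
    (μ : Fin n → Measure ℝ) [∀ i, SigmaFinite (μ i)]
    (hμ : ∀ i, i ∉ Set.range σ → μ i = Measure.dirac 0) :
    Measure.pi μ = (Measure.pi fun j => μ (σ j)).map fun u => extend σ u (0 : Fin n → ℝ) := by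
  classical
  refine (Measure.pi_eq fun S hS => ?_)
  rw [Measure.map_apply (measurable_extend_zero hσ) (MeasurableSet.univ_pi hS),
    ← Finset.prod_mul_prod_compl (Finset.univ.image σ), Finset.prod_image fun _ _ _ _ h => hσ h]
  have hc : ∀ i ∈ (Finset.univ.image σ)ᶜ, μ i (S i) = (S i).indicator 1 (0 : ℝ) := by
    intro i hi
    rw [hμ i (by simpa using hi), Measure.dirac_apply' _ (hS i)]
  rw [Finset.prod_congr rfl hc]
  by_cases h0 : ∀ i, i ∉ Set.range σ → (0 : ℝ) ∈ S i
  · have hpre : (fun u : Fin s → ℝ => extend σ u (0 : Fin n → ℝ)) ⁻¹' Set.univ.pi S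
        = Set.univ.pi fun j => S (σ j) := by
      ext u
      simp only [Set.mem_preimage, Set.mem_pi, Set.mem_univ, true_imp_iff]
      constructor
      · intro h j
        simpa only [hσ.extend_apply] using h (σ j)
      · intro h i
        by_cases hi : ∃ j, σ j = i
        · obtain ⟨j, rfl⟩ := hi
          rw [hσ.extend_apply]; exact h j
        · rw [extend_apply' _ _ _ hi]; exact h0 i hi
    have h1 : ∏ i ∈ (Finset.univ.image σ)ᶜ, (S i).indicator (1 : ℝ → ENNReal) (0 : ℝ) = 1 := by
      refine Finset.prod_eq_one fun i hi => ?_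
      rw [Set.indicator_of_mem (h0 i (by simpa using hi))]
      rfl
    rw [hpre, Measure.pi_pi, h1, mul_one]
  · push Not at h0
    obtain ⟨i, hi, hiS⟩ := h0
    have hpre : (fun u : Fin s → ℝ => extend σ u (0 : Fin n → ℝ)) ⁻¹' Set.univ.pi S = ∅ := by
      refine Set.eq_empty_of_forall_notMem fun u hu => hiS ?_
      have := hu i trivial
      simp only at this
      rwa [extend_apply' _ _ _ hi] at this
    rw [hpre, measure_empty, Finset.prod_eq_zero (i := i) (by simpa using hi), mul_zero]
    exact Set.indicator_of_notMem hiS _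

lemma injective_suppIdx {α : Fin n → ℤ} (h : (supp α).card = s) : Injective (suppIdx α h) :=
  ((supp α).orderEmbOfFin h).injective

lemma range_suppIdx {α : Fin n → ℤ} (h : (supp α).card = s) :
    Set.range (suppIdx α h) = {i | α i ≠ 0} := by
  rw [suppIdx, Finset.range_orderEmbOfFin]
  simp [supp]

lemma mulVec_eq_subMatrix {α : Fin n → ℤ} (h : (supp α).card = s) {t : Fin n → ℝ}
    (ht : ∀ i, α i = 0 → t i = 0) :
    Ξ.mulVec t = (subMatrix Ξ α h).mulVec fun j => t (suppIdx α h j) := by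
  ext l
  simp only [Matrix.mulVec, dotProduct, subMatrix, Matrix.submatrix_apply, id]
  rw [← Finset.sum_image (f := fun i => Ξ l i * t i) (g := suppIdx α h)
    fun _ _ _ _ hij => injective_suppIdx h hij]
  symm
  refine Finset.sum_subset (Finset.subset_univ _) fun i _ hi => ?_
  rw [ht i, mul_zero]
  by_contra h0
  have : i ∈ Set.range (suppIdx α h) := by rw [range_suppIdx]; exact h0
  simp at hi this
  exact this.elim hi

lemma IsReduced.eq_zero_of_isRelation {α : Fin n → ℤ} (hα : IsReduced Ξ α)
    (h : (supp α).card = s) {w : Fin n → ℝ} (hw : IsRelation Ξ α w) : w = 0 := by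
  have h1 := hw.1
  rw [mulVec_eq_subMatrix h hw.2] at h1
  have h2 := Matrix.eq_zero_of_mulVec_eq_zero (hα.det_ne_zero h) h1
  ext i
  by_cases hi : α i = 0
  · exact hw.2 i hi
  · have : i ∈ Set.range (suppIdx α h) := by rw [range_suppIdx]; exact hi
    obtain ⟨j, rfl⟩ := this
    exact congrFun h2 j

/-- No non-zero relation is left, so all weights on the support may be unbounded, and every
remaining unit weight can release its difference. -/
lemma expPairing_eq_pairing_pow (hcol : ∀ j, Ξ.col j ≠ 0) {α : Fin n → ℤ} (hα : IsReduced Ξ α)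
    (h : (supp α).card = s) {φ : (Fin s → ℝ) → ℝ}
    (hφ : ContDiff ℝ 1 φ) (hc : HasCompactSupport φ) :
    expPairing Ξ α φ = pairing Ξ
      (fun i => if α i = 0 then .zero else .pow (α i - 1).toNat) (diffSet Ξ Finset.univ φ) := by
  set B : Finset (Fin n) := Finset.univ.filter fun i => α i ≠ 1 with hB
  have hadm : ∀ τ : Fin n → Marginal, (∀ i k, τ i = .pow k → α i ≠ 0) → Admissible Ξ τ :=
    fun τ hτ => admissible_of_lead hcol fun i k hik => ⟨hτ i k hik, fun w hw l _ => by
      rw [hα.eq_zero_of_isRelation h hw, Pi.zero_apply]⟩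
  have hadmC : ∀ C : Finset (Fin n), (∀ i ∈ C, α i = 1) →
      Admissible Ξ fun i => if i ∈ C then .pow 0 else kind (α i) := by
    intro C hC
    refine hadm _ fun i k hik => ?_
    by_cases hi : i ∈ C
    · rw [hC i hi]; exact one_ne_zero
    · rw [if_neg hi] at hik
      have := kind_eq_pow hik
      omega
  -- `C` is the set of unit weights already split.
  have key : ∀ C : Finset (Fin n), (∀ i ∈ C, α i = 1) → expPairing Ξ α φ = pairing Ξ
      (fun i => if i ∈ C then .pow 0 else kind (α i)) (diffSet Ξ (C ∪ B) φ) := by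
    intro C
    induction C using Finset.induction_on with
    | empty => intro _; simp [expPairing, hB]
    | insert j C hj ih =>
      intro hC
      have hC' : ∀ i ∈ C, α i = 1 := fun i hi => hC i (Finset.mem_insert_of_mem hi)
      have hj1 : α j = 1 := hC j (Finset.mem_insert_self _ _)
      rw [ih hC', Finset.insert_union, diffSet_insert (by simp [hj, hB, hj1])]
      refine pairing_unit (by simp [hj, kind, hj1]) (by simp) (fun i hi => by simp [hi])
        (hadmC C hC') (hadmC _ hC) (hcol j) (contDiff_diffSet _ hφ).continuous
        (hasCompactSupport_diffSet _ hc)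
  rw [key (Finset.univ.filter fun i => α i = 1) (by simp)]
  congr 1
  · ext i : 1
    have := hα.nonneg i
    by_cases h0 : α i = 0
    · simp [h0, kind]
    · by_cases h1 : α i = 1
      · simp [h1]
      · simp only [Finset.mem_filter, Finset.mem_univ, true_and, if_neg h0, if_neg h1, kind]
        rw [if_neg (by omega)]
  · congr 1
    ext i
    by_cases h1 : α i = 1 <;> simp [hB, h1]

lemma measurable_truncPow (k : Fin s → ℕ) : Measurable fun y : Fin s → ℝ => truncPow y k :=
  Finset.measurable_prod _ fun j _ => (measurable_powDensity (k j)).comp (measurable_pi_apply j)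

lemma truncPow_nonneg (y : Fin s → ℝ) (k : Fin s → ℕ) : 0 ≤ truncPow y k :=
  Finset.prod_nonneg fun j _ => powDensity_nonneg (k j) (y j)

lemma integral_comp_mulVec {M : Matrix (Fin s) (Fin s) ℝ} (hM : M.det ≠ 0)
    {F : (Fin s → ℝ) → ℝ} (hF : Measurable F) :
    ∫ u, F (M.mulVec u) = |M.det|⁻¹ * ∫ x, F x := by
  have := Real.map_matrix_volume_pi_eq_smul_volume_pi hM
  have h1 : ∫ x, F x ∂Measure.map (Matrix.toLin' M) volume = ∫ u, F (M.mulVec u) := by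
    rw [integral_map (by fun_prop) hF.aestronglyMeasurable]
    rfl
  rw [← h1, this, integral_smul_measure, ENNReal.toReal_ofReal (abs_nonneg _), abs_inv,
    smul_eq_mul]

/-- The Dirac weights leave the `s` coordinates of the support, on which `Ξ` acts as the invertible
`subMatrix`; the substitution produces the truncated power and the Jacobian. -/
lemma expPairing_eq_integral (hcol : ∀ j, Ξ.col j ≠ 0) {α : Fin n → ℤ} (hα : IsReduced Ξ α)
    (h : (supp α).card = s) {φ : (Fin s → ℝ) → ℝ}
    (hφ : ContDiff ℝ 1 φ) (hc : HasCompactSupport φ) :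
    expPairing Ξ α φ = ∫ x, greenTerm Ξ α x * diffSet Ξ Finset.univ φ x := by
  have hdet := hα.det_ne_zero h
  set g := diffSet Ξ Finset.univ φ with hg
  have hgc : Continuous g := (contDiff_diffSet _ hφ).continuous
  set k : Fin s → ℕ := fun j => (α (suppIdx α h j) - 1).toNat with hk
  have hσ : ∀ j, α (suppIdx α h j) ≠ 0 := fun j => by
    have : suppIdx α h j ∈ {i | α i ≠ 0} := by rw [← range_suppIdx h]; exact ⟨j, rfl⟩
    exact this
  rw [expPairing_eq_pairing_pow hcol hα h hφ hc, pairing, ← hg,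
    pi_dirac_eq_map_extend (injective_suppIdx h), integral_map (f := fun t => g (Ξ.mulVec t))
    (measurable_extend_zero (injective_suppIdx h)).aemeasurable
    (hgc.comp (by fun_prop : Continuous fun t => Ξ.mulVec t)).aestronglyMeasurable]
  · have h1 : (fun j => (if α (suppIdx α h j) = 0 then Marginal.zero else
        .pow (α (suppIdx α h j) - 1).toNat).measure)
        = fun j => volume.withDensity fun t => ENNReal.ofReal (powDensity (k j) t) := by
      ext j : 1
      rw [if_neg (hσ j)]
      rfl
    rw [h1, pi_withDensity _ _ fun j => (measurable_powDensity (k j)).ennreal_ofReal]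
    have h2 : (fun x : Fin s → ℝ => ∏ j, ENNReal.ofReal (powDensity (k j) (x j)))
        = fun x => ENNReal.ofReal (truncPow x k) := by
      ext x
      rw [← ENNReal.ofReal_prod_of_nonneg fun j _ => powDensity_nonneg _ _]
      rfl
    rw [h2, integral_withDensity_eq_integral_toReal_smul
      (measurable_truncPow k).ennreal_ofReal (by simp)]
    have h3 : ∀ u : Fin s → ℝ, (ENNReal.ofReal (truncPow u k)).toReal •
        g (Ξ.mulVec (extend (suppIdx α h) u 0))
        = (fun x => truncPow ((subMatrix Ξ α h)⁻¹.mulVec x) k * g x)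
          ((subMatrix Ξ α h).mulVec u) := by
      intro u
      have hu : (subMatrix Ξ α h)⁻¹.mulVec ((subMatrix Ξ α h).mulVec u) = u := by
        rw [Matrix.mulVec_mulVec, Matrix.nonsing_inv_mul _ hdet.isUnit, Matrix.one_mulVec]
      simp only [hu]
      rw [ENNReal.toReal_ofReal (truncPow_nonneg u k),
        mulVec_eq_subMatrix h, smul_eq_mul]
      · simp only [(injective_suppIdx h).extend_apply]
      · intro i hi
        refine extend_apply' _ _ _ ?_
        rintro ⟨j, rfl⟩
        exact hσ j hi
    simp only [h3]
    change ∫ u, _ = _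
    rw [integral_comp_mulVec hdet (F := fun x => truncPow ((subMatrix Ξ α h)⁻¹.mulVec x) k * g x)]
    · rw [← integral_const_mul]
      refine integral_congr_ae (ae_of_all _ fun x => ?_)
      simp only [greenTerm, dif_pos h]
      ring
    · exact ((measurable_truncPow k).comp
        (by fun_prop : Continuous fun x => (subMatrix Ξ α h)⁻¹.mulVec x).measurable).mul
        hgc.measurable
  · intro i hi
    rw [range_suppIdx] at hi
    simp only [Set.mem_ofPred_eq, not_not] at hi
    simp [hi, Marginal.measure]

/-! ### The box spline as density of the image of the cube. -/

/-- The columns of `J` are an orthonormal basis of the kernel of `Ξ`. -/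
structure IsKernelFrame {d : ℕ} (Ξ : Matrix (Fin s) (Fin n) ℝ) (J : Matrix (Fin n) (Fin d) ℝ) :
    Prop where
  transpose_mul : J.transpose * J = 1
  mul_eq_zero : Ξ * J = 0
  exists_mulVec : ∀ v, Ξ.mulVec v = 0 → ∃ w, v = J.mulVec w

lemma exists_isKernelFrame (hrank : Ξ.rank = s) :
    ∃ J : Matrix (Fin n) (Fin (n - s)) ℝ, IsKernelFrame Ξ J := by
  let L : EuclideanSpace ℝ (Fin n) →ₗ[ℝ] (Fin s → ℝ) :=
    Ξ.mulVecLin ∘ₗ (WithLp.linearEquiv 2 ℝ (Fin n → ℝ)).toLinearMap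
  have hL : ∀ v, L v = Ξ.mulVec v.ofLp := fun v => rfl
  have hdim : Module.finrank ℝ (LinearMap.ker L) = n - s := by
    have h1 := L.finrank_range_add_finrank_ker
    have h2 : Module.finrank ℝ (LinearMap.range L) = s := by
      rw [LinearMap.range_comp, LinearEquiv.range, Submodule.map_top]
      exact hrank
    rw [h2, finrank_euclideanSpace_fin] at h1
    omega
  let b : OrthonormalBasis (Fin (n - s)) ℝ (LinearMap.ker L) :=
    (stdOrthonormalBasis ℝ (LinearMap.ker L)).reindex (finCongr hdim)
  have hcol : ∀ (w : Fin (n - s) → ℝ) (i : Fin n),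
      ((∑ j, w j • b j : LinearMap.ker L) : EuclideanSpace ℝ (Fin n)) i
        = ∑ j, (b j : EuclideanSpace ℝ (Fin n)) i * w j := by
    intro w i
    simp [mul_comm]
  refine ⟨Matrix.of fun i j => (b j : EuclideanSpace ℝ (Fin n)) i, ?_, ?_, fun v hv => ?_⟩
  · ext j k
    have := b.inner_eq_ite j k
    rw [Submodule.coe_inner, PiLp.inner_apply] at this
    rw [Matrix.mul_apply, Matrix.one_apply, ← this]
    exact Finset.sum_congr rfl fun i _ => by simp [mul_comm]
  · ext l j
    have : L (b j) = 0 := (b j).2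
    rw [hL] at this
    exact congrFun this l
  · let v' : LinearMap.ker L := ⟨WithLp.toLp 2 v, hv⟩
    refine ⟨fun j => b.repr v' j, ?_⟩
    ext i
    have h1 := b.sum_repr v'
    have h2 := hcol (fun j => b.repr v' j) i
    rw [h1] at h2
    exact h2

lemma isUnit_det_mul_transpose (hrank : Ξ.rank = s) : IsUnit (Ξ * Ξ.transpose).det := by
  have h1 : (Ξ * Ξ.transpose).rank = s := by rw [Matrix.rank_self_mul_transpose, hrank]
  have h2 : LinearMap.range (Ξ * Ξ.transpose).mulVecLin = ⊤ := by
    refine Submodule.eq_top_of_finrank_eq ?_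
    rw [Module.finrank_fin_fun]
    exact h1
  rw [← Matrix.isUnit_iff_isUnit_det, ← Matrix.mulVec_surjective_iff_isUnit]
  exact LinearMap.range_eq_top.1 h2

/-- The right inverse `Ξᵀ (Ξ Ξᵀ)⁻¹`. -/
noncomputable def rightInverse (Ξ : Matrix (Fin s) (Fin n) ℝ) : Matrix (Fin n) (Fin s) ℝ :=
  Ξ.transpose * (Ξ * Ξ.transpose)⁻¹

lemma mul_rightInverse (hrank : Ξ.rank = s) : Ξ * rightInverse Ξ = 1 := by
  rw [rightInverse, ← Matrix.mul_assoc, Matrix.mul_nonsing_inv _ (isUnit_det_mul_transpose hrank)]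

lemma mulVec_section (hrank : Ξ.rank = s) {d : ℕ} {J : Matrix (Fin n) (Fin d) ℝ}
    (hJ : IsKernelFrame Ξ J) (y : Fin s → ℝ) (w : Fin d → ℝ) :
    Ξ.mulVec ((rightInverse Ξ).mulVec y + J.mulVec w) = y := by
  rw [Matrix.mulVec_add, Matrix.mulVec_mulVec, Matrix.mulVec_mulVec, mul_rightInverse hrank,
    hJ.mul_eq_zero, Matrix.one_mulVec, Matrix.zero_mulVec, add_zero]

lemma rank_le_width (hrank : Ξ.rank = s) : s ≤ n := by
  rw [← hrank]; exact Ξ.rank_le_width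

/-- The index bijection between the `s` coordinates of the image and the `n - s` coordinates of
the kernel on one side, and the `n` coordinates of the parameter space on the other. -/
def sumFinEquiv (h : s ≤ n) : Fin s ⊕ Fin (n - s) ≃ Fin n :=
  finSumFinEquiv.trans (finCongr (by omega))

/-- The square matrix whose columns are those of the right inverse and of `J`. -/
noncomputable def frameMatrix (h : s ≤ n) (Ξ : Matrix (Fin s) (Fin n) ℝ)
    (J : Matrix (Fin n) (Fin (n - s)) ℝ) : Matrix (Fin n) (Fin n) ℝ :=
  (Matrix.fromCols (rightInverse Ξ) J).submatrix id (sumFinEquiv h).symm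

/-- The columns of the right inverse lie in the row space of `Ξ`, orthogonal to those of `J`. So the
Gram matrix of the frame is block diagonal with blocks $(\Xi\Xi^T)^{-1}$ and $1$. -/
lemma det_frameMatrix (hrank : Ξ.rank = s) {J : Matrix (Fin n) (Fin (n - s)) ℝ}
    (hJ : IsKernelFrame Ξ J) :
    |(frameMatrix (rank_le_width hrank) Ξ J).det|⁻¹ = Real.sqrt (Ξ * Ξ.transpose).det ∧
      (frameMatrix (rank_le_width hrank) Ξ J).det ≠ 0 := by
  have hG := isUnit_det_mul_transpose hrank
  set Q := frameMatrix (rank_le_width hrank) Ξ J with hQ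
  have h1 : Q.transpose * Q = ((Matrix.fromCols (rightInverse Ξ) J).transpose *
      Matrix.fromCols (rightInverse Ξ) J).submatrix
        (sumFinEquiv (rank_le_width hrank)).symm (sumFinEquiv (rank_le_width hrank)).symm := by
    rw [hQ, frameMatrix, Matrix.transpose_submatrix]
    rfl
  have hsymm : ((Ξ * Ξ.transpose)⁻¹).transpose = (Ξ * Ξ.transpose)⁻¹ := by
    rw [Matrix.transpose_nonsing_inv, Matrix.transpose_mul, Matrix.transpose_transpose]
  have hPP : (rightInverse Ξ).transpose * rightInverse Ξ = (Ξ * Ξ.transpose)⁻¹ := by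
    nth_rewrite 1 [rightInverse]
    rw [Matrix.transpose_mul, Matrix.transpose_transpose, hsymm, Matrix.mul_assoc,
      mul_rightInverse hrank, Matrix.mul_one]
  have hPJ : (rightInverse Ξ).transpose * J = 0 := by
    rw [rightInverse, Matrix.transpose_mul, Matrix.transpose_transpose, Matrix.mul_assoc,
      hJ.mul_eq_zero, Matrix.mul_zero]
  have h2 : Q.det * Q.det = (Ξ * Ξ.transpose).det⁻¹ := by
    nth_rewrite 1 [← Matrix.det_transpose]
    rw [← Matrix.det_mul, h1, Matrix.det_submatrix_equiv_self, Matrix.transpose_fromCols,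
      Matrix.fromRows_mul_fromCols, hPP, hPJ, hJ.transpose_mul, Matrix.det_fromBlocks_zero₁₂,
      Matrix.det_one, mul_one, Matrix.det_nonsing_inv, Ring.inverse_eq_inv']
  refine ⟨?_, fun h0 => ?_⟩
  · rw [← Real.sqrt_mul_self_eq_abs, h2, Real.sqrt_inv, inv_inv]
  · rw [h0, mul_zero] at h2
    exact hG.ne_zero (inv_eq_zero.1 h2.symm)

lemma frameMatrix_mulVec (h : s ≤ n) (J : Matrix (Fin n) (Fin (n - s)) ℝ)
    (y : Fin s → ℝ) (w : Fin (n - s) → ℝ) :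
    (frameMatrix h Ξ J).mulVec (Sum.elim y w ∘ (sumFinEquiv h).symm)
      = (rightInverse Ξ).mulVec y + J.mulVec w := by
  rw [frameMatrix, Matrix.submatrix_mulVec_equiv, Equiv.symm_symm]
  have : (Sum.elim y w ∘ (sumFinEquiv h).symm) ∘ (sumFinEquiv h) = Sum.elim y w := by
    ext i; simp
  rw [this, Matrix.fromCols_mulVec]
  simp

/-- The coarea formula for the linear map `Ξ`, from the frame coordinates and Fubini. -/
lemma integral_section (hrank : Ξ.rank = s) {J : Matrix (Fin n) (Fin (n - s)) ℝ}
    (hJ : IsKernelFrame Ξ J) {F : (Fin n → ℝ) → ℝ} (hF : Measurable F) (hFi : Integrable F) :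
    Integrable (fun p : (Fin s → ℝ) × (Fin (n - s) → ℝ) =>
      F ((rightInverse Ξ).mulVec p.1 + J.mulVec p.2)) ∧
    ∫ y, (∫ w, F ((rightInverse Ξ).mulVec y + J.mulVec w)) / Real.sqrt (Ξ * Ξ.transpose).det
      = ∫ t, F t := by
  have h := rank_le_width hrank
  obtain ⟨hdet, hne⟩ := det_frameMatrix hrank hJ
  let e : ((Fin s → ℝ) × (Fin (n - s) → ℝ)) ≃ᵐ (Fin n → ℝ) :=
    (MeasurableEquiv.sumPiEquivProdPi fun _ : Fin s ⊕ Fin (n - s) => ℝ).symm.trans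
      (MeasurableEquiv.piCongrLeft (fun _ : Fin n => ℝ) (sumFinEquiv h))
  have he : MeasurePreserving e volume volume :=
    (volume_measurePreserving_sumPiEquivProdPi_symm fun _ : Fin s ⊕ Fin (n - s) => ℝ).trans
      (volume_measurePreserving_piCongrLeft (fun _ : Fin n => ℝ) (sumFinEquiv h))
  have hes : ∀ p, e p = Sum.elim p.1 p.2 ∘ (sumFinEquiv h).symm := by
    intro p
    ext i
    obtain ⟨j, rfl⟩ := (sumFinEquiv h).surjective i
    have h1 : e p (sumFinEquiv h j) = (MeasurableEquiv.sumPiEquivProdPi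
        fun _ : Fin s ⊕ Fin (n - s) => ℝ).symm p j :=
      Equiv.piCongrLeft_apply_apply (fun _ : Fin n => ℝ) (sumFinEquiv h) _ j
    rw [h1]
    cases j <;> simp [MeasurableEquiv.sumPiEquivProdPi]
  have hQ : ∀ p, (frameMatrix h Ξ J).mulVec (e p)
      = (rightInverse Ξ).mulVec p.1 + J.mulVec p.2 := fun p => by
    rw [hes, frameMatrix_mulVec]
  have hint : Integrable fun u => F ((frameMatrix h Ξ J).mulVec u) := by
    have h1 : Integrable F (Measure.map (Matrix.toLin' (frameMatrix h Ξ J)) volume) := by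
      rw [Real.map_matrix_volume_pi_eq_smul_volume_pi hne]
      exact hFi.smul_measure ENNReal.ofReal_ne_top
    exact (integrable_map_measure hF.aestronglyMeasurable (by fun_prop)).1 h1
  have hint' : Integrable (fun p : (Fin s → ℝ) × (Fin (n - s) → ℝ) =>
      F ((rightInverse Ξ).mulVec p.1 + J.mulVec p.2)) := by
    have := (he.integrable_comp_emb e.measurableEmbedding).2 hint
    simpa only [comp_def, hQ] using this
  refine ⟨hint', ?_⟩
  have h3 := integral_comp_mulVec hne hF
  rw [← he.integral_comp e.measurableEmbedding] at h3
  simp only [hQ, hdet] at h3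
  rw [integral_div, ← integral_prod (f := fun p : (Fin s → ℝ) × (Fin (n - s) → ℝ) =>
      F ((rightInverse Ξ).mulVec p.1 + J.mulVec p.2)) hint']
  change (∫ p : (Fin s → ℝ) × (Fin (n - s) → ℝ), F ((rightInverse Ξ).mulVec p.1 + J.mulVec p.2)) / _ = _
  rw [h3, mul_comm, mul_div_assoc, div_self, mul_one]
  rw [← hdet]
  exact inv_ne_zero (abs_ne_zero.2 hne)

/-- The fibre of the unit cube over `x`, in the coordinates given by `J`. -/
def fibre {d : ℕ} (Ξ : Matrix (Fin s) (Fin n) ℝ) (J : Matrix (Fin n) (Fin d) ℝ) (x : Fin s → ℝ) :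
    Set (Fin d → ℝ) :=
  {w | (rightInverse Ξ).mulVec x + J.mulVec w ∈ Set.Icc (0 : Fin n → ℝ) 1}

lemma isClosed_fibre {d : ℕ} (J : Matrix (Fin n) (Fin d) ℝ) (x : Fin s → ℝ) :
    IsClosed (fibre Ξ J x) :=
  isClosed_Icc.preimage (by fun_prop)

/-- Orthonormality of `J` makes the parametrization of the fibre an isometry, which carries Lebesgue
measure to Hausdorff measure. -/
lemma boxSpline_eq (hrank : Ξ.rank = s) {J : Matrix (Fin n) (Fin (n - s)) ℝ}
    (hJ : IsKernelFrame Ξ J) (x : Fin s → ℝ) :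
    boxSpline Ξ x = (volume (fibre Ξ J x)).toReal / Real.sqrt (Ξ * Ξ.transpose).det := by
  let ι : EuclideanSpace ℝ (Fin (n - s)) → EuclideanSpace ℝ (Fin n) := fun w =>
    WithLp.toLp 2 ((rightInverse Ξ).mulVec x + J.mulVec w.ofLp)
  have hι : Isometry ι := by
    refine Isometry.of_dist_eq fun w w' => ?_
    rw [EuclideanSpace.dist_eq, EuclideanSpace.dist_eq]
    congr 1
    simp only [Real.dist_eq, sq_abs]
    have h1 : ∀ {m : ℕ} (u : Fin m → ℝ), ∑ i, u i ^ 2 = u ⬝ᵥ u := fun u => by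
      simp [dotProduct, sq]
    have h2 : ∀ i, (ι w) i - (ι w') i = J.mulVec (w.ofLp - w'.ofLp) i := fun i => by
      simp [ι, Matrix.mulVec_sub]
    simp only [h2]
    rw [h1 (J.mulVec (w.ofLp - w'.ofLp)), Matrix.dotProduct_mulVec, ← Matrix.mulVec_transpose,
      Matrix.mulVec_mulVec, hJ.transpose_mul, Matrix.one_mulVec, ← h1]
    rfl
  have himg : {t | t ∈ unitCube n ∧ Ξ.mulVec (fun i => t i) = x}
      = ι '' (WithLp.ofLp ⁻¹' fibre Ξ J x) := by
    ext t
    constructor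
    · rintro ⟨ht, hx⟩
      have hk : Ξ.mulVec (t.ofLp - (rightInverse Ξ).mulVec x) = 0 := by
        rw [Matrix.mulVec_sub, Matrix.mulVec_mulVec, mul_rightInverse hrank, Matrix.one_mulVec]
        exact sub_eq_zero.2 hx
      obtain ⟨w, hw⟩ := hJ.exists_mulVec _ hk
      have hw' : (rightInverse Ξ).mulVec x + J.mulVec w = t.ofLp := by rw [← hw]; abel
      refine ⟨WithLp.toLp 2 w, ?_, ?_⟩
      · change (rightInverse Ξ).mulVec x + J.mulVec w ∈ Set.Icc (0 : Fin n → ℝ) 1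
        rw [hw']
        exact ⟨fun i => (ht i).1, fun i => (ht i).2⟩
      · change WithLp.toLp 2 ((rightInverse Ξ).mulVec x + J.mulVec w) = t
        rw [hw']
    · rintro ⟨w, hw, rfl⟩
      exact ⟨fun i => ⟨hw.1 i, hw.2 i⟩, mulVec_section hrank hJ x w.ofLp⟩
  rw [boxSpline, himg, hι.euclideanHausdorffMeasure_image,
    EuclideanSpace.euclideanHausdorffMeasure_eq_volume,
    (PiLp.volume_preserving_ofLp (Fin (n - s))).measure_preimage
      (isClosed_fibre J x).measurableSet.nullMeasurableSet]

lemma integral_boxSpline (hrank : Ξ.rank = s) {φ : (Fin s → ℝ) → ℝ} (hφ : Continuous φ) :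
    Integrable (fun x => boxSpline Ξ x * φ x) ∧
      ∫ x, boxSpline Ξ x * φ x = ∫ t in Set.Icc (0 : Fin n → ℝ) 1, φ (Ξ.mulVec t) := by
  obtain ⟨J, hJ⟩ := exists_isKernelFrame hrank
  have hcont : Continuous fun t => φ (Ξ.mulVec t) := by fun_prop
  obtain ⟨hi, he⟩ := integral_section hrank hJ
    (F := (Set.Icc (0 : Fin n → ℝ) 1).indicator fun t => φ (Ξ.mulVec t))
    (hcont.measurable.indicator measurableSet_Icc)
    ((integrable_indicator_iff measurableSet_Icc).2
      (hcont.continuousOn.integrableOn_compact isCompact_Icc))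
  have key : ∀ y, (∫ w, (Set.Icc (0 : Fin n → ℝ) 1).indicator (fun t => φ (Ξ.mulVec t))
      ((rightInverse Ξ).mulVec y + J.mulVec w)) / Real.sqrt (Ξ * Ξ.transpose).det
      = boxSpline Ξ y * φ y := by
    intro y
    have h1 : ∀ w, (Set.Icc (0 : Fin n → ℝ) 1).indicator (fun t => φ (Ξ.mulVec t))
        ((rightInverse Ξ).mulVec y + J.mulVec w) = (fibre Ξ J y).indicator (fun _ => φ y) w := by
      intro w
      simp only [Set.indicator, mulVec_section hrank hJ]
      rfl
    simp only [h1]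
    rw [integral_indicator (isClosed_fibre J y).measurableSet, setIntegral_const,
      boxSpline_eq hrank hJ, smul_eq_mul, measureReal_def]
    ring
  simp only [key] at he
  refine ⟨?_, by rw [he, integral_indicator measurableSet_Icc]⟩
  have := (hi.integral_prod_left (E := ℝ)).div_const (Real.sqrt (Ξ * Ξ.transpose).det)
  simpa only [key] using this

/-! ### The mesh, and continuity off the mesh. -/

lemma mesh_eq_iUnion : mesh Ξ = ⋃ A : Finset (Fin n), ⋃ B ∈ {B : Finset (Fin n) |
    B.card + 1 = s ∧ LinearIndependent ℝ (fun i : B => Ξ.col i)},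
    (fun x => x - vertex Ξ A) ⁻¹' (Submodule.span ℝ (Ξ.col '' (B : Set (Fin n))) :
      Set (Fin s → ℝ)) := by
  ext x
  simp only [mesh, Set.mem_iUnion, Set.mem_preimage, SetLike.mem_coe, exists_prop,
    Set.mem_ofPred_eq, and_assoc]

lemma isClosed_mesh : IsClosed (mesh Ξ) := by
  rw [mesh_eq_iUnion]
  exact isClosed_iUnion_of_finite fun A => (Set.toFinite _).isClosed_biUnion fun B _ =>
    (Submodule.closed_of_finiteDimensional _).preimage (by fun_prop)

lemma volume_mesh : volume (mesh Ξ) = 0 := by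
  rw [mesh_eq_iUnion]
  refine measure_iUnion_null fun A => (measure_biUnion_null_iff (Set.to_countable _)).2
    fun B hB => ?_
  simp only [sub_eq_add_neg]
  rw [measure_preimage_add_right]
  refine Measure.addHaar_submodule _ _ fun htop => ?_
  have h1 : Module.finrank ℝ (Submodule.span ℝ (Ξ.col '' (B : Set (Fin n)))) ≤ B.card := by
    have := finrank_span_finset_le_card (R := ℝ) (B.image Ξ.col)
    rw [Finset.coe_image] at this
    exact this.trans Finset.card_image_le
  rw [htop, finrank_top, Module.finrank_fin_fun] at h1
  have := hB.1
  omega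

/-- By `hi`, $\xi_i$ is outside the span of the other columns, which therefore has dimension $s-1$.
Modulo that span $\Xi t$ equals $t_i\xi_i$, the vertex of `∅` or of `{i}`. -/
lemma mem_mesh_of_apply_eq (hrank : Ξ.rank = s) {i : Fin n}
    (hi : ∀ v, Ξ.mulVec v = 0 → v i = 0) {t : Fin n → ℝ} (ht : t i = 0 ∨ t i = 1) :
    Ξ.mulVec t ∈ mesh Ξ := by
  classical
  obtain ⟨b, hb, -, hspan, hli⟩ := exists_linearIndepOn_extension (K := ℝ) (v := Ξ.col)
    (s := ∅) (t := {i}ᶜ) (linearIndepOn_empty _ _) (Set.empty_subset _)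
  have hsum : ∀ v : Fin n → ℝ, Ξ.mulVec v = ∑ l, v l • Ξ.col l := fun v => by
    ext l
    simp [Matrix.mulVec, dotProduct, mul_comm]
  have hmem : ∀ v : Fin n → ℝ, Ξ.mulVec v - v i • Ξ.col i ∈ Submodule.span ℝ (Ξ.col '' b) := by
    intro v
    rw [hsum, ← Finset.add_sum_erase _ _ (Finset.mem_univ i), add_sub_cancel_left]
    exact Submodule.sum_mem _ fun l hl => Submodule.smul_mem _ _
      (hspan ⟨l, by simpa using hl, rfl⟩)
  have hib : i ∉ b := fun h => hb h rfl
  have hni : Ξ.col i ∉ Submodule.span ℝ (Ξ.col '' b) := by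
    intro h
    rw [Finsupp.mem_span_image_iff_linearCombination] at h
    obtain ⟨l, hl, hli⟩ := h
    have h0 : Ξ.mulVec (Pi.single i 1 - ⇑l) = 0 := by
      rw [Matrix.mulVec_sub, Matrix.mulVec_single_one, ← hli, hsum,
        Finsupp.linearCombination_apply, Finsupp.sum_fintype _ _ (by simp), sub_self]
    have := hi _ h0
    have hl0 : l i = 0 := by
      by_contra hne
      exact hib (hl (Finsupp.mem_support_iff.2 hne))
    simp [hl0] at this
  have hcard : b.toFinset.card + 1 = s := by
    have hli' : LinearIndepOn ℝ Ξ.col (insert i b) := hli.insert hni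
    have htop : Submodule.span ℝ (Ξ.col '' insert i b) = ⊤ := by
      rw [eq_top_iff, ← span_col_eq_top hrank, Submodule.span_le]
      rintro _ ⟨l, rfl⟩
      by_cases hl : l = i
      · subst hl
        exact Submodule.subset_span ⟨l, Set.mem_insert _ _, rfl⟩
      · exact Submodule.span_mono (Set.image_mono (Set.subset_insert _ _)) (hspan ⟨l, hl, rfl⟩)
    have h1 := finrank_span_eq_card (b := fun l : (insert i b : Set (Fin n)) => Ξ.col l) hli'
    rw [show Set.range (fun l : (insert i b : Set (Fin n)) => Ξ.col l) = Ξ.col '' insert i b by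
      rw [Set.image_eq_range], htop, finrank_top, Module.finrank_fin_fun, ← Set.toFinset_card,
      Set.toFinset_insert, Finset.card_insert_of_notMem (by simpa using hib)] at h1
    exact h1.symm
  refine ⟨if t i = 0 then ∅ else {i}, b.toFinset, hcard, ?_, ?_⟩
  · have hli2 : LinearIndepOn ℝ Ξ.col (b.toFinset : Set (Fin n)) := by
      rw [Set.coe_toFinset]; exact hli
    exact hli2
  · rw [Set.coe_toFinset]
    have := hmem t
    rcases ht with h | h <;> simpa [h, vertex] using this

lemma volume_setOf_add_eq {d : ℕ} {L : (Fin d → ℝ) →ₗ[ℝ] ℝ} (hL : L ≠ 0) (a c : ℝ) :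
    volume {w | a + L w = c} = 0 := by
  by_cases h : ∃ w₀, a + L w₀ = c
  · obtain ⟨w₀, hw₀⟩ := h
    have : {w | a + L w = c} = (fun w => w + -w₀) ⁻¹' (LinearMap.ker L : Set (Fin d → ℝ)) := by
      ext w
      simp only [Set.mem_ofPred_eq, Set.mem_preimage, SetLike.mem_coe, LinearMap.mem_ker, map_add,
        map_neg]
      rw [← hw₀, add_right_inj, ← sub_eq_add_neg, sub_eq_zero]
    rw [this, measure_preimage_add_right]
    exact Measure.addHaar_submodule _ _ fun h => hL (LinearMap.ker_eq_top.1 h)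
  · have : {w | a + L w = c} = ∅ := Set.eq_empty_of_forall_notMem fun w hw => h ⟨w, hw⟩
    rw [this, measure_empty]

lemma eventually_mem_Icc_iff {X : Type*} [TopologicalSpace X] {f : X → ℝ} {x : X}
    (hf : ContinuousAt f x) (h0 : f x ≠ 0) (h1 : f x ≠ 1) :
    ∀ᶠ y in 𝓝 x, (0 ≤ f y ∧ f y ≤ 1 ↔ 0 ≤ f x ∧ f x ≤ 1) := by
  rcases lt_or_gt_of_ne h0 with h | h
  · filter_upwards [hf.eventually_lt_const h] with y hy
    constructor <;> intro h' <;> linarith [h'.1]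
  · rcases lt_or_gt_of_ne h1 with h' | h'
    · filter_upwards [hf.eventually_const_lt h, hf.eventually_lt_const h'] with y hy hy'
      exact ⟨fun _ => ⟨h.le, h'.le⟩, fun _ => ⟨hy.le, hy'.le⟩⟩
    · filter_upwards [hf.eventually_const_lt h'] with y hy
      constructor <;> intro h'' <;> linarith [h''.2]

/-- Indicators of the fibres converge at `w` unless some coordinate of the cube point is 0 or 1
there. If that coordinate varies on the fibre, this is a null set of `w`; if it is constant, `x`
lies in the mesh. -/
lemma continuousOn_boxSpline (hrank : Ξ.rank = s) :
    ContinuousOn (boxSpline Ξ) (mesh Ξ)ᶜ := by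
  obtain ⟨J, hJ⟩ := exists_isKernelFrame hrank
  intro x hx
  refine ContinuousAt.continuousWithinAt ?_
  -- A compact set containing all fibres near `x`: `w` is recovered from the cube point by
  -- `J.transpose`.
  have hcompact : IsCompact ((fun p : (Fin n → ℝ) × (Fin s → ℝ) =>
      J.transpose.mulVec (p.1 - (rightInverse Ξ).mulVec p.2)) ''
        (Set.Icc (0 : Fin n → ℝ) 1 ×ˢ Metric.closedBall x 1)) :=
    (isCompact_Icc.prod (isCompact_closedBall x 1)).image (by fun_prop)
  have hlim : Tendsto (fun y => volume (fibre Ξ J y)) (𝓝 x) (𝓝 (volume (fibre Ξ J x))) := by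
    refine tendsto_measure_of_ae_tendsto_indicator (𝓝 x) (isClosed_fibre J x).measurableSet
      (fun y => (isClosed_fibre J y).measurableSet) hcompact.isClosed.measurableSet
      hcompact.measure_lt_top.ne ?_ ?_
    · filter_upwards [Metric.closedBall_mem_nhds x one_pos] with y hy w hw
      refine ⟨((rightInverse Ξ).mulVec y + J.mulVec w, y), ⟨hw, hy⟩, ?_⟩
      simp only [add_sub_cancel_left]
      rw [Matrix.mulVec_mulVec, hJ.transpose_mul, Matrix.one_mulVec]
    · have hae : ∀ i, ∀ᵐ w : Fin (n - s) → ℝ, ∀ c : ℝ, (c = 0 ∨ c = 1) →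
          (rightInverse Ξ).mulVec x i + J.mulVec w i ≠ c := by
        intro i
        by_cases hrow : (LinearMap.proj i ∘ₗ J.mulVecLin : (Fin (n - s) → ℝ) →ₗ[ℝ] ℝ) = 0
        · have h0 : ∀ w, J.mulVec w i = 0 := fun w => LinearMap.congr_fun hrow w
          refine ae_of_all _ fun w c hc he => hx ?_
          rw [h0, add_zero] at he
          have hv : ∀ v, Ξ.mulVec v = 0 → v i = 0 := fun v hv => by
            obtain ⟨w, rfl⟩ := hJ.exists_mulVec v hv
            exact h0 w
          have := mem_mesh_of_apply_eq hrank hv (t := (rightInverse Ξ).mulVec x) (by rwa [he])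
          rwa [Matrix.mulVec_mulVec, mul_rightInverse hrank, Matrix.one_mulVec] at this
        · have h : ∀ c, ∀ᵐ w : Fin (n - s) → ℝ,
              (rightInverse Ξ).mulVec x i + J.mulVec w i ≠ c := fun c => by
            rw [ae_iff]
            simpa using! volume_setOf_add_eq hrow ((rightInverse Ξ).mulVec x i) c
          filter_upwards [h 0, h 1] with w h0 h1 c hc
          rcases hc with rfl | rfl
          exacts [h0, h1]
      filter_upwards [ae_all_iff.2 hae] with w hw
      have hev : ∀ i, ∀ᶠ y in 𝓝 x,
          (0 ≤ (rightInverse Ξ).mulVec y i + J.mulVec w i ∧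
            (rightInverse Ξ).mulVec y i + J.mulVec w i ≤ 1 ↔
          0 ≤ (rightInverse Ξ).mulVec x i + J.mulVec w i ∧
            (rightInverse Ξ).mulVec x i + J.mulVec w i ≤ 1) := fun i => by
        have hc : Continuous fun y => (rightInverse Ξ).mulVec y i + J.mulVec w i :=
          ((continuous_apply i).comp (by fun_prop :
            Continuous fun y => (rightInverse Ξ).mulVec y)).add continuous_const
        exact eventually_mem_Icc_iff hc.continuousAt (hw i 0 (Or.inl rfl)) (hw i 1 (Or.inr rfl))
      filter_upwards [eventually_all.2 hev] with y hy
      simp only [fibre, Set.mem_ofPred_eq, Set.mem_Icc, Pi.le_def, Pi.add_apply, Pi.zero_apply,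
        Pi.one_apply, ← forall_and, hy]
  have hne : volume (fibre Ξ J x) ≠ ⊤ := by
    refine (lt_of_le_of_lt (measure_mono fun w hw => ?_) hcompact.measure_lt_top).ne
    refine ⟨((rightInverse Ξ).mulVec x + J.mulVec w, x),
      ⟨hw, Metric.mem_closedBall_self zero_le_one⟩, ?_⟩
    simp only [add_sub_cancel_left]
    rw [Matrix.mulVec_mulVec, hJ.transpose_mul, Matrix.one_mulVec]
  have := ((ENNReal.tendsto_toReal hne).comp hlim).div_const (Real.sqrt (Ξ * Ξ.transpose).det)
  rw [ContinuousAt, boxSpline_eq hrank hJ]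
  exact this.congr fun y => (boxSpline_eq hrank hJ y).symm

lemma continuousAt_powDensity (k : ℕ) {t : ℝ} (ht : t ≠ 0) : ContinuousAt (powDensity k) t := by
  unfold powDensity
  refine ContinuousAt.div_const ?_ _
  rcases lt_or_gt_of_ne ht with h | h
  · refine (continuousAt_const (y := (0 : ℝ))).congr ?_
    filter_upwards [eventually_lt_nhds h] with u hu
    rw [if_neg (not_le.2 hu)]
  · refine (continuousAt_id.pow k).congr ?_
    filter_upwards [eventually_gt_nhds h] with u hu
    rw [if_pos (le_of_lt hu)]
    rfl

/-- A jump needs a zero coordinate of $\Xi_\alpha^{-1}(x-p)$, which puts $x-p$ in the span of the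
other $s-1$ columns of $\Xi_\alpha$. -/
lemma continuousOn_greenTerm {α : Fin n → ℤ} (hα : IsReduced Ξ α) (h : (supp α).card = s)
    (A : Finset (Fin n)) :
    ContinuousOn (fun x => greenTerm Ξ α (x - vertex Ξ A)) (mesh Ξ)ᶜ := by
  classical
  intro x hx
  refine ContinuousAt.continuousWithinAt ?_
  have hdet := hα.det_ne_zero h
  simp only [greenTerm, dif_pos h]
  refine ContinuousAt.div_const ?_ _
  unfold truncPow
  refine tendsto_finsetProd _ fun j _ => ?_
  have hc : Continuous fun x => (subMatrix Ξ α h)⁻¹.mulVec (x - vertex Ξ A) j :=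
    (continuous_apply j).comp (by fun_prop :
      Continuous fun x => (subMatrix Ξ α h)⁻¹.mulVec (x - vertex Ξ A))
  refine ContinuousAt.comp (g := powDensity _)
    (f := fun x => (subMatrix Ξ α h)⁻¹.mulVec (x - vertex Ξ A) j)
    (continuousAt_powDensity _ fun h0 => hx ?_) hc.continuousAt
  set u := (subMatrix Ξ α h)⁻¹.mulVec (x - vertex Ξ A) with hu
  have hxu : x - vertex Ξ A = ∑ l, u l • Ξ.col (suppIdx α h l) := by
    have h1 : (subMatrix Ξ α h).mulVec u = x - vertex Ξ A := by
      rw [hu, Matrix.mulVec_mulVec, Matrix.mul_nonsing_inv _ hdet.isUnit, Matrix.one_mulVec]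
    rw [← h1]
    ext l
    simp [Matrix.mulVec, dotProduct, mul_comm, subMatrix]
  have hmem : ∀ l, suppIdx α h l ∈ supp α := fun l => (supp α).orderEmbOfFin_mem h l
  have hli : LinearIndepOn ℝ Ξ.col (supp α : Set (Fin n)) := by
    have h1 : LinearIndependent ℝ (subMatrix Ξ α h).col :=
      Matrix.linearIndependent_cols_iff_isUnit.2
        ((Matrix.isUnit_iff_isUnit_det _).2 hdet.isUnit)
    have h2 : LinearIndepOn ℝ Ξ.col (Set.range (suppIdx α h)) :=
      (linearIndepOn_range_iff (injective_suppIdx h) _).2 h1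
    rwa [range_suppIdx, show {i | α i ≠ 0} = (supp α : Set (Fin n)) by ext; simp [supp]] at h2
  refine ⟨A, (supp α).erase (suppIdx α h j), ?_, ?_, ?_⟩
  · rw [Finset.card_erase_add_one (hmem j), h]
  · exact hli.mono (t := (((supp α).erase (suppIdx α h j) : Finset (Fin n)) : Set (Fin n)))
      (by simp)
  · rw [hxu]
    refine Submodule.sum_mem _ fun l _ => ?_
    by_cases hl : l = j
    · rw [hl, h0, zero_smul]; exact Submodule.zero_mem _
    · exact Submodule.smul_mem _ _ (Submodule.subset_span
        ⟨_, Finset.mem_coe.2 (Finset.mem_erase.2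
          ⟨fun he => hl (injective_suppIdx h he), hmem l⟩), rfl⟩)

/-! ### Local integrability and comparison of the two distributions. -/

lemma locallyIntegrable_greenTerm (α : Fin n → ℤ) (v : Fin s → ℝ) :
    LocallyIntegrable fun x => greenTerm Ξ α (x - v) := by
  by_cases h : (supp α).card = s
  · set k : Fin s → ℕ := fun j => (α (suppIdx α h j) - 1).toNat with hk
    have hc : Continuous fun x : Fin s → ℝ => (∏ j, |(subMatrix Ξ α h)⁻¹.mulVec (x - v) j| ^ k j /
        (Nat.factorial (k j) : ℝ)) / |(subMatrix Ξ α h).det| := by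
      refine Continuous.div_const (continuous_finsetProd _ fun j _ => ?_) _
      exact ((((continuous_apply j).comp (by fun_prop :
        Continuous fun x => (subMatrix Ξ α h)⁻¹.mulVec (x - v))).abs).pow _).div_const _
    have hg : (fun x => greenTerm Ξ α (x - v)) = fun x =>
        truncPow ((subMatrix Ξ α h)⁻¹.mulVec (x - v)) k / |(subMatrix Ξ α h).det| := by
      ext x; simp only [greenTerm, dif_pos h, hk]
    refine hc.locallyIntegrable.mono ?_ (ae_of_all _ fun x => ?_)
    · rw [hg]
      exact (((measurable_truncPow k).comp (by fun_prop :
        Continuous fun x => (subMatrix Ξ α h)⁻¹.mulVec (x - v)).measurable).div_const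
          _).aestronglyMeasurable
    · rw [congrFun hg x, Real.norm_of_nonneg (div_nonneg (truncPow_nonneg _ _) (abs_nonneg _)),
        Real.norm_of_nonneg (by positivity)]
      gcongr
      exact Finset.prod_le_prod (fun j _ => powDensity_nonneg _ _) fun j _ => powDensity_le _ _
  · have : (fun x => greenTerm Ξ α (x - v)) = fun _ => (0 : ℝ) := by ext x; simp only [greenTerm, dif_neg h]
    rw [this]
    exact locallyIntegrable_const 0

lemma continuousOn_multisetSum {X ι : Type*} [TopologicalSpace X] {S : Set X} (P : Multiset ι)
    {f : ι → X → ℝ} (hf : ∀ q ∈ P, ContinuousOn (f q) S) :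
    ContinuousOn (fun x => (P.map fun q => f q x).sum) S := by
  induction P using Multiset.induction_on with
  | empty => simpa using continuousOn_const
  | cons q P ih =>
    simp only [Multiset.map_cons, Multiset.sum_cons]
    exact (hf q (Multiset.mem_cons_self q P)).add
      (ih fun q' hq' => hf q' (Multiset.mem_cons_of_mem hq'))

lemma locallyIntegrable_multisetSum {X ι : Type*} [TopologicalSpace X] [MeasurableSpace X]
    {μ : Measure X} (P : Multiset ι) {f : ι → X → ℝ} (hf : ∀ q ∈ P, LocallyIntegrable (f q) μ) :
    LocallyIntegrable (fun x => (P.map fun q => f q x).sum) μ := by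
  induction P using Multiset.induction_on with
  | empty =>
    simpa using (locallyIntegrable_zero : LocallyIntegrable (fun _ : X => (0 : ℝ)) μ)
  | cons q P ih =>
    simp only [Multiset.map_cons, Multiset.sum_cons]
    exact (hf q (Multiset.mem_cons_self q P)).add
      (ih fun q' hq' => hf q' (Multiset.mem_cons_of_mem hq'))

lemma integral_multisetSum {X ι : Type*} [MeasurableSpace X]
    {μ : Measure X} (P : Multiset ι) {f : ι → X → ℝ} (hf : ∀ q ∈ P, Integrable (f q) μ) :
    Integrable (fun x => (P.map fun q => f q x).sum) μ ∧
      ∫ x, (P.map fun q => f q x).sum ∂μ = (P.map fun q => ∫ x, f q x ∂μ).sum := by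
  induction P using Multiset.induction_on with
  | empty => simp
  | cons q P ih =>
    simp only [Multiset.map_cons, Multiset.sum_cons]
    have hq := hf q (Multiset.mem_cons_self q P)
    obtain ⟨h1, h2⟩ := ih fun q' hq' => hf q' (Multiset.mem_cons_of_mem hq')
    exact ⟨hq.add h1, by rw [integral_add hq h1, h2]⟩

/-- With all exponents 1 no difference is split off, so the recursion starts from the integral over
the cube. -/
lemma expPairing_one (hrank : Ξ.rank = s) {φ : (Fin s → ℝ) → ℝ} (hφ : Continuous φ) :
    expPairing Ξ (fun _ => 1) φ = ∫ x, boxSpline Ξ x * φ x := by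
  have h1 : (Finset.univ.filter fun _ : Fin n => (1 : ℤ) ≠ 1) = ∅ := by simp
  rw [(integral_boxSpline hrank hφ).2, expPairing, h1, diffSet_empty, pairing, ← Set.pi_univ_Icc,
    volume_pi, Measure.restrict_pi_pi]
  simp [kind, Marginal.measure]

lemma sum_diffPairs (f : ℝ → (Fin s → ℝ) → ℝ) :
    ((diffPairs Ξ).map fun bp => f bp.1 bp.2).sum
      = ∑ A : Finset (Fin n), f ((-1) ^ A.card) (vertex Ξ A) := by
  rw [diffPairs, Multiset.map_map]
  rfl

/-- The combination of Green's functions that belongs to a multiset of pairs. -/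
noncomputable def greenSum (Ξ : Matrix (Fin s) (Fin n) ℝ) (P : Multiset (ℝ × (Fin n → ℤ)))
    (x : Fin s → ℝ) : ℝ :=
  (P.map fun q => q.1 * greenTerm Ξ q.2 x).sum

lemma locallyIntegrable_greenSum (P : Multiset (ℝ × (Fin n → ℤ))) (v : Fin s → ℝ) :
    LocallyIntegrable fun x => greenSum Ξ P (x - v) :=
  locallyIntegrable_multisetSum P fun q _ => (locallyIntegrable_greenTerm q.2 v).smul q.1

lemma integral_greenSum (hcol : ∀ j, Ξ.col j ≠ 0) {P : Multiset (ℝ × (Fin n → ℤ))}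
    (hP : ∀ q ∈ P, IsReduced Ξ q.2 ∧ (supp q.2).card = s) {φ : (Fin s → ℝ) → ℝ}
    (hφ : ContDiff ℝ 1 φ) (hc : HasCompactSupport φ) :
    ∫ x, greenSum Ξ P x * diffSet Ξ Finset.univ φ x
      = (P.map fun q => q.1 * expPairing Ξ q.2 φ).sum := by
  have hi : ∀ q ∈ P, Integrable fun x => q.1 * greenTerm Ξ q.2 x * diffSet Ξ Finset.univ φ x := by
    intro q _
    have h1 : LocallyIntegrable (greenTerm Ξ q.2) := by
      simpa using locallyIntegrable_greenTerm (Ξ := Ξ) q.2 0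
    simpa only [smul_eq_mul, mul_assoc] using
      (h1.integrable_smul_right_of_hasCompactSupport
        (contDiff_diffSet _ hφ).continuous (hasCompactSupport_diffSet _ hc)).const_mul q.1
  have h2 := (integral_multisetSum P hi).2
  simp only [Multiset.sum_map_mul_right] at h2
  simp only [greenSum]
  rw [h2]
  congr 1
  refine Multiset.map_congr rfl fun q hq => ?_
  rw [expPairing_eq_integral hcol (hP q hq).1 (hP q hq).2 hφ hc, ← integral_const_mul]
  simp only [mul_assoc]

/-- Translation invariance moves the differences from the test function to the Green's functions. -/
lemma integral_sum_translate (P : Multiset (ℝ × (Fin n → ℤ))) {φ : (Fin s → ℝ) → ℝ}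
    (hφ : Continuous φ) (hc : HasCompactSupport φ) :
    ∫ x, (∑ A : Finset (Fin n), (-1) ^ A.card * greenSum Ξ P (x - vertex Ξ A)) * φ x
      = ∫ x, greenSum Ξ P x * diffSet Ξ Finset.univ φ x := by
  have h1 : ∀ A : Finset (Fin n), Integrable fun x =>
      (-1) ^ A.card * (greenSum Ξ P (x - vertex Ξ A) * φ x) := fun A =>
    ((locallyIntegrable_greenSum P _).integrable_smul_right_of_hasCompactSupport hφ hc).const_mul _
  have h2 : ∀ A : Finset (Fin n), Integrable fun x =>
      (-1) ^ A.card * (greenSum Ξ P x * φ (x + vertex Ξ A)) := fun A => by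
    have := (h1 A).comp_add_right (vertex Ξ A)
    simpa using this
  simp only [diffSet, Finset.powerset_univ, Finset.sum_mul, Finset.mul_sum, mul_assoc,
    mul_left_comm (greenSum Ξ P _)]
  rw [integral_finsetSum _ fun A _ => h1 A, integral_finsetSum _ fun A _ => h2 A]
  refine Finset.sum_congr rfl fun A _ => ?_
  rw [← integral_add_right_eq_self _ (vertex Ξ A)]
  simp only [add_sub_cancel_right]

end BoxSpline

theorem mainTheorem1 (s n : ℕ) (Ξ : Matrix (Fin s) (Fin n) ℝ)
    (hrank : Ξ.rank = s) (hcol : ∀ j, Ξ.col j ≠ 0)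
    (K : Matrix (Fin n) (Fin (n - s)) ℝ) (hK : BoxSpline.IsKernelMatrix Ξ K)
    (ν : (Fin n → ℤ) → Fin n → ℝ)
    (hν : ∀ α : Fin n → ℤ, s < (BoxSpline.supp α).card → BoxSpline.IsNu K α (ν α)) :
    (∀ q ∈ BoxSpline.greenPairs ν (n - s), (∀ i, 0 ≤ q.2 i) ∧
      ∃ h : (BoxSpline.supp q.2).card = s, (BoxSpline.subMatrix Ξ q.2 h).det ≠ 0) ∧
    MeasureTheory.volume (BoxSpline.mesh Ξ) = 0 ∧
    ∀ x : Fin s → ℝ, x ∉ BoxSpline.mesh Ξ →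
      BoxSpline.boxSpline Ξ x =
        ((BoxSpline.diffPairs Ξ).map fun bp =>
          ((BoxSpline.greenPairs ν (n - s)).map fun ca =>
            bp.1 * ca.1 * BoxSpline.greenTerm Ξ ca.2 (x - bp.2)).sum).sum := by
  open BoxSpline in
  have hsn := rank_le_width hrank
  have hP : ∀ q ∈ greenPairs ν (n - s), IsReduced Ξ q.2 ∧ (supp q.2).card = s := fun q hq => by
    obtain ⟨h1, h2⟩ := mem_greenPairs hrank hK hν (n - s) (by omega) q hq
    exact ⟨h1, by omega⟩
  refine ⟨fun q hq => ⟨(hP q hq).1.nonneg, (hP q hq).2, (hP q hq).1.det_ne_zero (hP q hq).2⟩,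
    volume_mesh, ?_⟩
  set P := greenPairs ν (n - s) with hPdef
  have hrhs : ∀ x, ((diffPairs Ξ).map fun bp => (P.map fun ca =>
      bp.1 * ca.1 * greenTerm Ξ ca.2 (x - bp.2)).sum).sum
      = ∑ A : Finset (Fin n), (-1) ^ A.card * greenSum Ξ P (x - vertex Ξ A) := fun x => by
    rw [sum_diffPairs fun b p => (P.map fun ca => b * ca.1 * greenTerm Ξ ca.2 (x - p)).sum]
    simp only [mul_assoc, Multiset.sum_map_mul_left, greenSum]
  simp only [hrhs]
  have hloc : LocallyIntegrable fun x =>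
      ∑ A : Finset (Fin n), (-1) ^ A.card * greenSum Ξ P (x - vertex Ξ A) :=
    locallyIntegrable_finsetSum _ fun A _ =>
      (locallyIntegrable_greenSum P (vertex Ξ A)).smul ((-1 : ℝ) ^ A.card)
  have hbox : LocallyIntegrable (boxSpline Ξ) := by
    have := (integral_boxSpline hrank (φ := fun _ => 1) continuous_const).1
    simp only [mul_one] at this
    exact this.locallyIntegrable
  have hae := ae_eq_of_integral_contDiff_smul_eq hbox hloc fun φ hφ hc => by
    have hφ1 : ContDiff ℝ 1 φ := hφ.of_le (by exact_mod_cast le_top)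
    have h1 := expPairing_one hrank hφ1.continuous
    have h2 := sum_greenPairs hrank hcol hK hν hφ1 hc (n - s) (by omega)
    have h3 := integral_greenSum hcol hP hφ1 hc
    have h4 := integral_sum_translate (Ξ := Ξ) P hφ1.continuous hc
    simp only [smul_eq_mul, mul_comm (φ _)]
    rw [h4, h3, h2, h1]
  have hcont : ContinuousOn (fun x =>
      ∑ A : Finset (Fin n), (-1) ^ A.card * greenSum Ξ P (x - vertex Ξ A)) (mesh Ξ)ᶜ :=
    continuousOn_finsetSum _ fun A _ => continuousOn_const.mul
      (continuousOn_multisetSum P fun q hq => continuousOn_const.mul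
        (continuousOn_greenTerm (hP q hq).1 (hP q hq).2 A))
  -- Lebesgue measure charges every non-empty open set, so almost everywhere equality of continuous
  -- functions is equality.
  exact fun x hx => Measure.eqOn_open_of_ae_eq (ae_restrict_of_ae hae)
    isClosed_mesh.isOpen_compl (continuousOn_boxSpline hrank) hcont hx
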